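/- Computational model. Algorithms are deterministic and run on a word RAM with unit-cost word operations; on instances of size parameter $N$ memory cells have $O(\log N)$ bits and all input numbers are bounded by $N^{c}$ for an arbitrary constant $c$ (a time bound below is meant for every such constant $c$; the algorithm and the constants hidden in $O(\cdot)$, but not the exponents, may depend on $c$). For the SubsetSum problems $N = n + 1/\varepsilon$, for MinConv $N = n$. Problems. For a finite set $X$ of $n$ positive integers and a target $t \ge 1$ let $\mathrm{OPT} = \max\{\Sigma(Y) : Y \subseteq X,\ \Sigma(Y) \le t\}$, where $\Sigma(Y) = \sum_{y\in Y} y$. - An *approximation scheme for SubsetSum* is an algorithm that, given $X$, $t$ and a rational $\varepsilon \in (0,1)$, computes a subset $Y \subseteq X$ with $(1-\varepsilon)\,\mathrm{OPT} \le \Sigma(Y) \le \mathrm{OPT}$. - *GapSubsetSum*: given $X$, $t$ and a rational $\varepsilon \in (0,1)$, distinguish whether $\mathrm{OPT} = t$ or $\mathrm{OPT} < (1-\varepsilon)t$; if $\mathrm{OPT} \in [(1-\varepsilon)t, t)$, the output can be arbitrary. - *MinConv*: given sequences $A[0..n-1]$ and $B[0..n-1]$ ($n \ge 1$) of positive integers,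 compute $C[k] = \min\{A[i]+B[j] : 0 \le i,j < n,\ i+j=k\}$ for all $0 \le k \le 2n-2$. Theorem (Reduction from MinConv to SubsetSum). 1. If SubsetSum has an approximation scheme running in time $O((n+1/\varepsilon)^{2-\delta})$ for some $\delta > 0$, then MinConv can be solved in time $O(n^{2-\delta'})$ for some $\delta' > 0$. 2. The same conclusion holds already if GapSubsetSum can be solved in time $O((n+1/\varepsilon)^{2-\delta})$ for some $\delta > 0$. -/

import Mathlib

/-! ## Word RAM

Structured programs over finitely many registers and a memory of natural-number cells, with
indirect addressing. Every instruction and every branch test costs one time step. -/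

namespace WordRAM

/-- The unit-cost word operations. -/
inductive Op
  | add | sub | mul | div | mod | land | lor | xor | shl | shr | lt | eq

/-- Meaning of the word operations: subtraction is truncated at `0`, division by `0` gives `0`,
comparisons give `1` (true) or `0` (false). -/
def Op.eval : Op → ℕ → ℕ → ℕ
  | .add, x, y => x + y
  | .sub, x, y => x - y
  | .mul, x, y => x * y
  | .div, x, y => x / y
  | .mod, x, y => x % y
  | .land, x, y => x &&& y
  | .lor, x, y => x ||| y
  | .xor, x, y => x ^^^ y
  | .shl, x, y => x <<< y
  | .shr, x, y => x >>> y
  | .lt, x, y => if x < y then 1 else 0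
  | .eq, x, y => if x = y then 1 else 0

/-- Programs. The natural numbers `r a b` are names of registers (a program is a finite term, so
it uses finitely many registers); `v` is a constant. -/
inductive Prog
  /-- do nothing -/
  | skip
  /-- `R[r] := v` -/
  | const (r v : ℕ)
  /-- `R[r] := R[a] o R[b]` -/
  | op (o : Op) (r a b : ℕ)
  /-- `R[r] := Mem[R[a]]` -/
  | load (r a : ℕ)
  /-- `Mem[R[a]] := R[r]` -/
  | store (a r : ℕ)
  /-- first `P`, then `Q` -/
  | seq (P Q : Prog)
  /-- if `R[r] ≠ 0` then `P` else `Q` -/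
  | ite (r : ℕ) (P Q : Prog)
  /-- while `R[r] ≠ 0` do `P` -/
  | loop (r : ℕ) (P : Prog)

/-- Contents of the registers and of the memory. -/
structure State where
  reg : ℕ → ℕ
  mem : ℕ → ℕ

/-- `R[r] := v`. -/
def State.setReg (s : State) (r v : ℕ) : State := ⟨Function.update s.reg r v, s.mem⟩

/-- `Mem[a] := v`. -/
def State.setMem (s : State) (a v : ℕ) : State := ⟨s.reg, Function.update s.mem a v⟩

/-- `Exec w P s T s'`: started in state `s`, the program `P` halts after exactly `T` steps in
state `s'`, and every number that it writes into a register (hence also every address that it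
uses and every number that it stores) fits into a word of `w` bits. There is no rule for a step
whose result does not fit, so an overflowing run does not count as a run. -/
inductive Exec (w : ℕ) : Prog → State → ℕ → State → Prop
  | skip (s : State) : Exec w .skip s 1 s
  | const (s : State) (r v : ℕ) (h : v < 2 ^ w) : Exec w (.const r v) s 1 (s.setReg r v)
  | op (s : State) (o : Op) (r a b : ℕ) (h : o.eval (s.reg a) (s.reg b) < 2 ^ w) :
      Exec w (.op o r a b) s 1 (s.setReg r (o.eval (s.reg a) (s.reg b)))
  | load (s : State) (r a : ℕ) (h : s.mem (s.reg a) < 2 ^ w) :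
      Exec w (.load r a) s 1 (s.setReg r (s.mem (s.reg a)))
  | store (s : State) (a r : ℕ) : Exec w (.store a r) s 1 (s.setMem (s.reg a) (s.reg r))
  | seq {P Q : Prog} {s s₁ s₂ : State} {T₁ T₂ : ℕ} (h₁ : Exec w P s T₁ s₁)
      (h₂ : Exec w Q s₁ T₂ s₂) : Exec w (.seq P Q) s (T₁ + T₂) s₂
  | ite_true {r : ℕ} {P Q : Prog} {s s₁ : State} {T : ℕ} (h : s.reg r ≠ 0)
      (h₁ : Exec w P s T s₁) : Exec w (.ite r P Q) s (T + 1) s₁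
  | ite_false {r : ℕ} {P Q : Prog} {s s₁ : State} {T : ℕ} (h : s.reg r = 0)
      (h₁ : Exec w Q s T s₁) : Exec w (.ite r P Q) s (T + 1) s₁
  | loop_done {r : ℕ} {P : Prog} {s : State} (h : s.reg r = 0) : Exec w (.loop r P) s 1 s
  | loop_step {r : ℕ} {P : Prog} {s s₁ s₂ : State} {T₁ T₂ : ℕ} (h : s.reg r ≠ 0)
      (h₁ : Exec w P s T₁ s₁) (h₂ : Exec w (.loop r P) s₁ T₂ s₂) :
      Exec w (.loop r P) s (T₁ + T₂ + 1) s₂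

/-- The initial state: the input list stands in the memory cells `0, 1, 2, …`; all other cells
and all registers are `0`. -/
def inputState (l : List ℕ) : State := ⟨fun _ => 0, fun a => l.getD a 0⟩

/-- On words of `w` bits and on input `l`, the program `P` halts after at most `T` steps, and the
final memory satisfies `Post`. -/
def HaltsWithin (w : ℕ) (P : Prog) (l : List ℕ) (T : ℝ) (Post : (ℕ → ℕ) → Prop) : Prop :=
  ∃ (τ : ℕ) (s : State), Exec w P (inputState l) τ s ∧ (τ : ℝ) ≤ T ∧ Post s.mem

end WordRAM

/-! ## The problems -/

/-- `OPT = max {Σ(Y) | Y ⊆ X, Σ(Y) ≤ t}` (the empty set is always a candidate). -/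
def subsetSumOpt (X : Finset ℕ) (t : ℕ) : ℕ :=
  (X.powerset.filter fun Y => ∑ y ∈ Y, y ≤ t).sup fun Y => ∑ y ∈ Y, y

/-- Output condition of an approximation scheme for SubsetSum: the memory holds, as
`|Y|, y₁, …, y_{|Y|}`, a subset `Y ⊆ X` with `(1 - ε) OPT ≤ Σ(Y) ≤ OPT`. -/
def IsApproxSubsetSumOutput (X : Finset ℕ) (t : ℕ) (ε : ℝ) (out : ℕ → ℕ) : Prop :=
  ∃ Y : List ℕ, Y.Nodup ∧ Y.toFinset ⊆ X ∧
    out 0 = Y.length ∧ (∀ (i : ℕ) (h : i < Y.length), out (i + 1) = Y[i]) ∧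
    (1 - ε) * (subsetSumOpt X t : ℝ) ≤ (Y.sum : ℝ) ∧ Y.sum ≤ subsetSumOpt X t

/-- Output condition for GapSubsetSum: cell `0` is `1` if `OPT = t`, and `0` if
`OPT < (1 - ε) t`; otherwise the output is arbitrary. -/
def IsGapSubsetSumOutput (X : Finset ℕ) (t : ℕ) (ε : ℝ) (out : ℕ → ℕ) : Prop :=
  (subsetSumOpt X t = t → out 0 = 1) ∧
    ((subsetSumOpt X t : ℝ) < (1 - ε) * (t : ℝ) → out 0 = 0)

/-- Output condition for MinConv: cell `k` holds `C[k] = min_{i+j=k} A[i] + B[j]`, for each of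
the `2n - 1` indices `k` for which there is such a pair `(i, j)`. -/
def IsMinConvOutput {n : ℕ} (A B : Fin n → ℕ) (out : ℕ → ℕ) : Prop :=
  ∀ k < 2 * n - 1,
    IsLeast {s : ℕ | ∃ i j : Fin n, (i : ℕ) + (j : ℕ) = k ∧ s = A i + B j} (out k)

/-- A SubsetSum-type problem with accuracy parameter `ε`, given by its output condition `Out`, can
be solved in time `O(T(n, 1/ε))` on the word RAM. The input consists of a set of `n` positive
integers (listed without repetition, in any order), a positive target `t` and a rational
`ε = p / q` in `(0, 1)`. With `L` the bit length of `n + ⌊1/ε⌋`, all input numbers have at most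
`c L` bits for an arbitrary constant `c`, i.e. they are polynomially bounded in `n + 1/ε`, and
words have `κ L = O(log (n + 1/ε))` bits. -/
def SubsetSumTypeInTime (Out : Finset ℕ → ℕ → ℝ → (ℕ → ℕ) → Prop) (T : ℕ → ℝ → ℝ) : Prop :=
  ∀ c : ℕ, ∃ (P : WordRAM.Prog) (κ : ℕ) (K : ℝ), ∀ (X : List ℕ) (t p q : ℕ),
    X.Nodup → (∀ x ∈ X, 0 < x ∧ x < 2 ^ (c * (X.length + q / p).size)) →
    0 < t → t < 2 ^ (c * (X.length + q / p).size) →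
    0 < p → p < q → q < 2 ^ (c * (X.length + q / p).size) →
    WordRAM.HaltsWithin (κ * (X.length + q / p).size) P (X.length :: t :: p :: q :: X)
      (K * T X.length ((q : ℝ) / (p : ℝ))) (Out X.toFinset t ((p : ℝ) / (q : ℝ)))

/-- SubsetSum has an approximation scheme running in time `O(T(n, 1/ε))`. -/
def SubsetSumApproxSchemeInTime (T : ℕ → ℝ → ℝ) : Prop :=
  SubsetSumTypeInTime IsApproxSubsetSumOutput T

/-- GapSubsetSum can be solved in time `O(T(n, 1/ε))`. -/
def GapSubsetSumInTime (T : ℕ → ℝ → ℝ) : Prop :=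
  SubsetSumTypeInTime IsGapSubsetSumOutput T

/-- MinConv can be solved in time `O(T(n))` on the word RAM, for sequences of length `n ≥ 1` with
entries in `{1, …, M}`, `M = n^{O(1)}`: the entries have at most `c L` bits, where `L` is the bit
length of `n` and `c` is an arbitrary constant, and words have `κ L = O(log n)` bits. -/
def MinConvInTime (T : ℕ → ℝ) : Prop :=
  ∀ c : ℕ, ∃ (P : WordRAM.Prog) (κ : ℕ) (K : ℝ), ∀ (n : ℕ) (A B : Fin n → ℕ), 1 ≤ n →
    (∀ i, 1 ≤ A i ∧ A i < 2 ^ (c * n.size)) → (∀ i, 1 ≤ B i ∧ B i < 2 ^ (c * n.size)) →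
    WordRAM.HaltsWithin (κ * n.size) P (n :: (List.ofFn A ++ List.ofFn B)) (K * T n)
      (IsMinConvOutput A B)

/-! MinConv is solved by a parallel binary search. Pad both sequences to length `v = m ^ 3` with `m
= 2 ^ k`, where `k` is the least exponent with `n < 8 ^ k`, so that `m` is of order `n ^ (1/3)`.
Keep for every output index a threshold `E k`, a lower bound on the minimum that is tight up to the
current uncertainty. A round raises all thresholds by half the uncertainty and revokes the raises
that overshoot; after `L = O(log n)` rounds the thresholds are the minima.

To find the overshoots, cut both sequences into `m ^ 2` blocks of length `m`. For each of the `m ^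
4` block pairs the question whether some `A i + B j < E (i + j)` becomes a gap instance with `4 * m
+ L` items and `ε = 1 / (1096 * m)`. Its numbers have a leading part, whose sum forces one item each
for `A`, `B` and `E` with matching indices, and a low part, where powers of two fill the remaining
difference exactly if the inequality is strict. Without a violation every subset sum that meets the
target bound stays a fraction `ε` below the target (`opt_eq_target`, `opt_lt_gap`).

On a positive answer all `m ^ 2` index pairs of the block pair are inspected. At least one raise is
revoked, so this happens at most `2 * v` times per round and costs `O(m ^ 5)`; the potential
`unmarked` accounts for it. The calls cost `O(m ^ (6 - δ))` per round for `δ ≤ 1`. Giving away half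
of `δ` absorbs the factor `L`, and `m ^ (6 - δ / 2) = (m ^ 3) ^ (2 - δ / 6)` is subquadratic in `n`
(`wp_processBlock`, `wp_round`, `wp_rounds`, `time_bound`).

The given solver expects a memory that is zero outside its input. Each call therefore gets its own
residue class of addresses modulo a large `S` of polynomial size, which costs only a constant factor
in word length (`Exec.embed`, `HaltsWithin.call`). Both parts of the theorem pass through
`HasGapSubroutine`: under the gap promise an approximation scheme decides the instance by the sum of
its output. -/

namespace WordRAM

/-! ### Weakest preconditions for word RAM programs -/

@[simp] theorem State.setReg_reg (s : State) (r v r' : ℕ) :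
    (s.setReg r v).reg r' = if r' = r then v else s.reg r' := by
  simp [State.setReg, Function.update_apply]

@[simp] theorem State.setReg_mem (s : State) (r v : ℕ) : (s.setReg r v).mem = s.mem := rfl

@[simp] theorem State.setMem_reg (s : State) (a v : ℕ) : (s.setMem a v).reg = s.reg := rfl

@[simp] theorem State.setMem_mem (s : State) (a v x : ℕ) :
    (s.setMem a v).mem x = if x = a then v else s.mem x := by
  simp [State.setMem, Function.update_apply]

/-- Weakest precondition: started in `s`, the program halts in a state that satisfies `Q`, which
may also mention the running time. -/
def WP (w : ℕ) (P : Prog) (Q : ℕ → State → Prop) (s : State) : Prop :=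
  ∃ τ s', Exec w P s τ s' ∧ Q τ s'

section WP

variable {w : ℕ} {Q : ℕ → State → Prop} {s : State}

theorem WP.mono {P : Prog} {Q' : ℕ → State → Prop} (h : WP w P Q s)
    (hQ : ∀ τ s', Q τ s' → Q' τ s') : WP w P Q' s := by
  obtain ⟨τ, s', h₁, h₂⟩ := h
  exact ⟨τ, s', h₁, hQ _ _ h₂⟩

@[simp] theorem wp_skip : WP w .skip Q s ↔ Q 1 s := by
  constructor
  · rintro ⟨τ, s', h, hQ⟩; cases h; exact hQ
  · exact fun h => ⟨_, _, .skip s, h⟩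

@[simp] theorem wp_const {r v : ℕ} : WP w (.const r v) Q s ↔ v < 2 ^ w ∧ Q 1 (s.setReg r v) := by
  constructor
  · rintro ⟨τ, s', h, hQ⟩; cases h; exact ⟨by assumption, hQ⟩
  · exact fun h => ⟨_, _, .const s r v h.1, h.2⟩

@[simp] theorem wp_op {o : Op} {r a b : ℕ} : WP w (.op o r a b) Q s ↔
    o.eval (s.reg a) (s.reg b) < 2 ^ w ∧ Q 1 (s.setReg r (o.eval (s.reg a) (s.reg b))) := by
  constructor
  · rintro ⟨τ, s', h, hQ⟩; cases h; exact ⟨by assumption, hQ⟩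
  · exact fun h => ⟨_, _, .op s o r a b h.1, h.2⟩

@[simp] theorem wp_load {r a : ℕ} : WP w (.load r a) Q s ↔
    s.mem (s.reg a) < 2 ^ w ∧ Q 1 (s.setReg r (s.mem (s.reg a))) := by
  constructor
  · rintro ⟨τ, s', h, hQ⟩; cases h; exact ⟨by assumption, hQ⟩
  · exact fun h => ⟨_, _, .load s r a h.1, h.2⟩

@[simp] theorem wp_store {a r : ℕ} : WP w (.store a r) Q s ↔
    Q 1 (s.setMem (s.reg a) (s.reg r)) := by
  constructor
  · rintro ⟨τ, s', h, hQ⟩; cases h; exact hQ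
  · exact fun h => ⟨_, _, .store s a r, h⟩

@[simp] theorem wp_seq {P R : Prog} : WP w (.seq P R) Q s ↔
    WP w P (fun τ₁ s₁ => WP w R (fun τ₂ s₂ => Q (τ₁ + τ₂) s₂) s₁) s := by
  constructor
  · rintro ⟨τ, s', h, hQ⟩
    cases h with
    | seq h₁ h₂ => exact ⟨_, _, h₁, _, _, h₂, hQ⟩
  · rintro ⟨τ₁, s₁, h₁, τ₂, s₂, h₂, hQ⟩
    exact ⟨_, _, .seq h₁ h₂, hQ⟩

@[simp] theorem wp_ite {r : ℕ} {P R : Prog} : WP w (.ite r P R) Q s ↔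
    (s.reg r ≠ 0 → WP w P (fun τ => Q (τ + 1)) s) ∧
      (s.reg r = 0 → WP w R (fun τ => Q (τ + 1)) s) := by
  constructor
  · rintro ⟨τ, s', h, hQ⟩
    cases h with
    | ite_true h h₁ => exact ⟨fun _ => ⟨_, _, h₁, hQ⟩, fun h' => absurd h' h⟩
    | ite_false h h₁ => exact ⟨fun h' => absurd h h', fun _ => ⟨_, _, h₁, hQ⟩⟩
  · rintro ⟨h₁, h₂⟩
    by_cases h : s.reg r = 0
    · obtain ⟨τ, s', he, hQ⟩ := h₂ h
      exact ⟨_, _, .ite_false h he, hQ⟩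
    · obtain ⟨τ, s', he, hQ⟩ := h₁ h
      exact ⟨_, _, .ite_true h he, hQ⟩

theorem WP.seq {P R : Prog} {Q₁ : ℕ → State → Prop} (h : WP w P Q₁ s)
    (hR : ∀ τ₁ s₁, Q₁ τ₁ s₁ → WP w R (fun τ₂ s₂ => Q (τ₁ + τ₂) s₂) s₁) :
    WP w (.seq P R) Q s :=
  wp_seq.2 (h.mono hR)

/-- Rule for a loop that runs `k` more times as long as `I k` holds; `Φ` is a potential, in which
iterations may store time. -/
theorem WP.loop {r : ℕ} {P : Prog} (I : ℕ → State → Prop) (Φ : State → ℕ) (T : ℕ)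
    (h0 : ∀ s, I 0 s → s.reg r = 0)
    (hstep : ∀ k s, I (k + 1) s → s.reg r ≠ 0 ∧
      WP w P (fun τ s' => I k s' ∧ τ + Φ s' ≤ T + Φ s) s)
    (k : ℕ) (hs : I k s) :
    WP w (.loop r P) (fun τ s' => I 0 s' ∧ τ + Φ s' ≤ k * (T + 1) + 1 + Φ s) s := by
  induction k generalizing s with
  | zero => exact ⟨_, _, .loop_done (h0 s hs), hs, by omega⟩
  | succ k ih =>
    obtain ⟨hr, τ₁, s₁, he₁, hI, hτ₁⟩ := hstep k s hs
    obtain ⟨τ₂, s₂, he₂, hI₂, hτ₂⟩ := ih hI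
    refine ⟨_, _, .loop_step hr he₁ he₂, hI₂, ?_⟩
    rw [Nat.succ_mul]
    omega

/-- `for R[r] := R[N] - 1, …, 0 do body`, provided that `R[0] = 0` and `R[1] = 1`. -/
def forDown (r N : ℕ) (body : Prog) : Prog :=
  .seq (.op .add r N 0) (.loop r (.seq (.op .sub r r 1) body))

/-- The invariant must not depend on the counter register (`hset`), and the potential sees only the
memory, so the bookkeeping of the loop disturbs neither. Each iteration pays two extra steps, for
the decrement and the loop test. -/
theorem WP.forDown {r N : ℕ} {body : Prog} (I : ℕ → State → Prop) (Φ : (ℕ → ℕ) → ℕ) (T : ℕ)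
    (hconst : ∀ k s, I k s → s.reg 0 = 0 ∧ s.reg 1 = 1)
    (hset : ∀ k s x, I k s → I k (s.setReg r x))
    (hw : s.reg N < 2 ^ w)
    (hbody : ∀ k < s.reg N, ∀ s₁, s₁.reg r = k → I (k + 1) s₁ →
      WP w body (fun τ s' => s'.reg r = k ∧ I k s' ∧ τ + Φ s'.mem ≤ T + Φ s₁.mem) s₁)
    (hs : I (s.reg N) s) :
    WP w (WordRAM.forDown r N body)
      (fun τ s' => I 0 s' ∧ τ + Φ s'.mem ≤ s.reg N * (T + 2) + 2 + Φ s.mem) s := by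
  have hc := hconst _ _ hs
  simp only [WordRAM.forDown, wp_seq, wp_op, Op.eval, hc.1, Nat.add_zero]
  refine ⟨hw, ?_⟩
  have key := WP.loop (w := w) (r := r) (P := .seq (.op .sub r r 1) body)
    (fun k s' => k ≤ s.reg N ∧ s'.reg r = k ∧ I k s') (fun s' => Φ s'.mem) (T + 1)
    (fun s' h => h.2.1) ?_ (s.reg N) (s := s.setReg r (s.reg N))
    ⟨le_rfl, by simp, hset _ _ _ hs⟩
  · refine key.mono fun τ s' h => ⟨h.1.2.2, ?_⟩
    have := h.2
    simp only [State.setReg_mem] at this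
    rw [show T + 1 + 1 = T + 2 from rfl] at this
    omega
  · rintro k s₁ ⟨hk, hr, hI⟩
    refine ⟨by omega, ?_⟩
    have hc₁ := hconst _ _ hI
    simp only [wp_seq, wp_op, Op.eval, hc₁.2, hr, Nat.add_sub_cancel]
    refine ⟨by omega, ?_⟩
    refine (hbody k (by omega) (s₁.setReg r k) (by simp) (hset _ _ _ hI)).mono ?_
    rintro τ s' ⟨h1, h2, h3⟩
    refine ⟨⟨by omega, h1, h2⟩, ?_⟩
    simp only [State.setReg_mem] at h3
    omega

end WP

/-! ### Embedding a program into a larger one -/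

/-- All registers of the program are below the result. -/
def Prog.bound : Prog → ℕ
  | .skip => 0
  | .const r _ => r + 1
  | .op _ r a b => max (r + 1) (max (a + 1) (b + 1))
  | .load r a => max (r + 1) (a + 1)
  | .store a r => max (a + 1) (r + 1)
  | .seq P Q => max P.bound Q.bound
  | .ite r P Q => max (r + 1) (max P.bound Q.bound)
  | .loop r P => max (r + 1) P.bound

/-- The program with its registers shifted by `40`, and its memory cell `a` moved to the address
`a * R[7] + R[8]`. Register `33` is used for the computation of addresses. -/
def Prog.embed : Prog → Prog
  | .skip => .skip
  | .const r v => .const (r + 40) v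
  | .op o r a b => .op o (r + 40) (a + 40) (b + 40)
  | .load r a => .seq (.op .mul 33 (a + 40) 7) (.seq (.op .add 33 33 8) (.load (r + 40) 33))
  | .store a r => .seq (.op .mul 33 (a + 40) 7) (.seq (.op .add 33 33 8) (.store 33 (r + 40)))
  | .seq P Q => .seq P.embed Q.embed
  | .ite r P Q => .ite (r + 40) P.embed Q.embed
  | .loop r P => .loop (r + 40) P.embed

/-- The state `s` of the larger machine represents the state `σ` of the embedded one, and agrees
with `s₀` on everything the embedded program has no access to. -/
structure Represents (b w S off : ℕ) (s₀ σ s : State) : Prop where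
  reg : ∀ r < b, s.reg (r + 40) = σ.reg r
  lt : ∀ r < b, σ.reg r < 2 ^ w
  mem : ∀ a, s.mem (a * S + off) = σ.mem a
  frame : ∀ r < 33, s.reg r = s₀.reg r
  frame_mem : ∀ x, (∀ a, x ≠ a * S + off) → s.mem x = s₀.mem x

theorem Represents.setReg {b w S off : ℕ} {s₀ σ s : State} (h : Represents b w S off s₀ σ s)
    (r v : ℕ) (hv : v < 2 ^ w) :
    Represents b w S off s₀ (σ.setReg r v) (s.setReg (r + 40) v) := by
  refine ⟨fun r' hr' => ?_, fun r' hr' => ?_, h.mem, fun r' hr' => ?_, h.frame_mem⟩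
  · by_cases e : r' = r <;> simp [e, h.reg r' hr']
  · by_cases e : r' = r <;> simp [e, h.lt r' hr', hv]
  · simpa [show r' ≠ r + 40 by omega] using h.frame r' hr'

theorem Represents.setScratch {b w S off : ℕ} {s₀ σ s : State} (h : Represents b w S off s₀ σ s)
    (v : ℕ) : Represents b w S off s₀ σ (s.setReg 33 v) := by
  refine ⟨fun r' hr' => ?_, h.lt, h.mem, fun r' hr' => ?_, h.frame_mem⟩
  · simpa using h.reg r' hr'
  · simpa [show r' ≠ 33 by omega] using h.frame r' hr'

theorem Represents.setMem {b w S off : ℕ} {s₀ σ s : State} (h : Represents b w S off s₀ σ s)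
    (hS : 0 < S) (a v : ℕ) :
    Represents b w S off s₀ (σ.setMem a v) (s.setMem (a * S + off) v) := by
  refine ⟨h.reg, h.lt, fun a' => ?_, h.frame, fun x hx => ?_⟩
  · simp [h.mem a', hS.ne']
  · simpa [hx a] using h.frame_mem x hx

/-- Induction on the run. The factor 3 comes from memory accesses, each preceded by two address
computations. Their results fit into a word by `haddr`, since `Represents` also records that the
simulated registers are below `2 ^ w`. -/
theorem Exec.embed {b w w' S off : ℕ} {s₀ : State} (hS : 0 < S) (hw : w ≤ w')
    (haddr : ∀ x < 2 ^ w, x * S + off < 2 ^ w') (h7 : s₀.reg 7 = S) (h8 : s₀.reg 8 = off)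
    {P : Prog} {σ σ' : State} {τ : ℕ} (he : Exec w P σ τ σ') (hb : P.bound ≤ b)
    {s : State} (hs : Represents b w S off s₀ σ s) :
    WP w' P.embed (fun τ' s' => τ' ≤ 3 * τ ∧ Represents b w S off s₀ σ' s') s := by
  have hpow : 2 ^ w ≤ 2 ^ w' := Nat.pow_le_pow_right (by norm_num) hw
  have mono {x : ℕ} (h : x < 2 ^ w) : x < 2 ^ w' := h.trans_le hpow
  have mulS {x : ℕ} (h : x < 2 ^ w) : x * S < 2 ^ w' :=
    lt_of_le_of_lt (Nat.le_add_right _ off) (haddr x h)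
  induction he generalizing s with
  | skip σ => simpa [Prog.embed] using hs
  | const σ r v h => simpa [Prog.embed] using ⟨mono h, hs.setReg r v h⟩
  | op σ o r a c h =>
    simp only [Prog.bound] at hb
    have ha := hs.reg a (by omega)
    have hc := hs.reg c (by omega)
    simp only [Prog.embed, wp_op, ha, hc]
    exact ⟨mono h, by omega, hs.setReg r _ h⟩
  | load σ r a h =>
    simp only [Prog.bound] at hb
    have ha := hs.reg a (by omega)
    have hl := hs.lt a (by omega)
    have h7' : s.reg 7 = S := (hs.frame 7 (by norm_num)).trans h7
    have h8' : s.reg 8 = off := (hs.frame 8 (by norm_num)).trans h8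
    have hs' := ((hs.setScratch (σ.reg a * S)).setScratch (σ.reg a * S + off)).setReg r _ h
    simp only [Prog.embed, wp_seq, wp_op, wp_load, Op.eval, State.setReg_reg, State.setReg_mem, ha,
      h7', h8', hs.mem, if_true, if_neg (show ¬ (8 = 33) by norm_num)]
    exact ⟨mulS hl, haddr _ hl, mono h, by omega, hs'⟩
  | store σ a r =>
    simp only [Prog.bound] at hb
    have ha := hs.reg a (by omega)
    have hr := hs.reg r (by omega)
    have hl := hs.lt a (by omega)
    have h7' : s.reg 7 = S := (hs.frame 7 (by norm_num)).trans h7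
    have h8' : s.reg 8 = off := (hs.frame 8 (by norm_num)).trans h8
    have hs' := ((hs.setScratch (σ.reg a * S)).setScratch (σ.reg a * S + off)).setMem hS
      (σ.reg a) (σ.reg r)
    simp only [Prog.embed, wp_seq, wp_op, wp_store, Op.eval, State.setReg_reg, ha, hr,
      h7', h8', if_true, if_neg (show ¬ (8 = 33) by norm_num),
      if_neg (show ¬ (r + 40 = 33) by omega)]
    exact ⟨mulS hl, haddr _ hl, by omega, hs'⟩
  | seq h₁ h₂ ih₁ ih₂ =>
    simp only [Prog.bound] at hb
    refine (ih₁ (by omega) hs).seq fun τ₁ s₁ h => ?_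
    exact (ih₂ (by omega) h.2).mono fun τ₂ s₂ h' => ⟨by omega, h'.2⟩
  | @ite_true r P Q σ σ₁ T h h₁ ih =>
    simp only [Prog.bound] at hb
    have hr := hs.reg r (by omega)
    rw [Prog.embed, wp_ite, hr]
    exact ⟨fun _ => (ih (by omega) hs).mono fun τ' s' h' => ⟨by omega, h'.2⟩,
      fun h' => absurd h' h⟩
  | @ite_false r P Q σ σ₁ T h h₁ ih =>
    simp only [Prog.bound] at hb
    have hr := hs.reg r (by omega)
    rw [Prog.embed, wp_ite, hr]
    exact ⟨fun h' => absurd h h', fun _ => (ih (by omega) hs).mono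
      fun τ' s' h' => ⟨by omega, h'.2⟩⟩
  | @loop_done r P σ h =>
    simp only [Prog.bound] at hb
    exact ⟨_, _, .loop_done ((hs.reg r (by omega)).trans h), by omega, hs⟩
  | @loop_step r P σ σ₁ σ₂ T₁ T₂ h h₁ h₂ ih₁ ih₂ =>
    have hb' := hb
    simp only [Prog.bound] at hb
    obtain ⟨t₁, s₁, e₁, ht₁, hs₁⟩ := ih₁ (by omega) hs
    obtain ⟨t₂, s₂, e₂, ht₂, hs₂⟩ := ih₂ hb' hs₁
    exact ⟨_, _, .loop_step ((hs.reg r (by omega)).trans_ne h) e₁ e₂, by omega, hs₂⟩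

/-- Set the registers `40, …, 40 + b - 1` to `0`. -/
def zeroRegs : ℕ → Prog
  | 0 => .skip
  | b + 1 => .seq (zeroRegs b) (.const (b + 40) 0)

theorem wp_zeroRegs {w : ℕ} (b : ℕ) (s : State) :
    WP w (zeroRegs b) (fun τ s' => τ ≤ b + 1 ∧ (∀ r < b, s'.reg (r + 40) = 0) ∧
      (∀ r < 40, s'.reg r = s.reg r) ∧ s'.mem = s.mem) s := by
  induction b with
  | zero => simp [zeroRegs]
  | succ b ih =>
    refine ih.seq fun τ s₁ ⟨h₁, h₂, h₃, h₄⟩ => ?_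
    simp only [wp_const]
    refine ⟨by positivity, by omega, fun r hr => ?_, fun r hr => ?_, h₄⟩
    · by_cases e : r = b
      · simp [e]
      · simpa [e] using h₂ r (by omega)
    · simpa [show r ≠ b + 40 by omega] using h₃ r hr

/-- Call the program `P` on fresh registers. -/
def Prog.call (P : Prog) : Prog := .seq (zeroRegs P.bound) P.embed

/-- The hypothesis `hmem` concerns every cell of the residue class: beyond the input the region has
to be zero, as in `inputState`. This is why regions are never reused. -/
theorem HaltsWithin.call {w w' S off : ℕ} {P : Prog} {l : List ℕ} {T : ℝ}
    {Post : (ℕ → ℕ) → Prop} (h : HaltsWithin w P l T Post) (hS : 0 < S) (hw : w ≤ w')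
    (haddr : ∀ x < 2 ^ w, x * S + off < 2 ^ w') {s : State} (h7 : s.reg 7 = S)
    (h8 : s.reg 8 = off) (hmem : ∀ a, s.mem (a * S + off) = l.getD a 0) :
    WP w' P.call (fun τ s' => (τ : ℝ) ≤ 3 * T + (P.bound + 1) ∧
      Post (fun a => s'.mem (a * S + off)) ∧ (∀ r < 33, s'.reg r = s.reg r) ∧
      ∀ x, (∀ a, x ≠ a * S + off) → s'.mem x = s.mem x) s := by
  obtain ⟨τ, σ, he, hτ, hP⟩ := h
  refine (wp_zeroRegs P.bound s).seq fun τ₁ s₁ ⟨h₁, h₂, h₃, h₄⟩ => ?_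
  have hs : Represents P.bound w S off s (inputState l) s₁ :=
    ⟨fun r hr => h₂ r hr, fun r _ => by simp [inputState], fun a => by rw [h₄, hmem]; rfl,
      fun r hr => h₃ r (by omega), fun x _ => by rw [h₄]⟩
  refine (he.embed hS hw haddr h7 h8 le_rfl hs).mono fun τ₂ s₂ ⟨ht, hr⟩ => ⟨?_, ?_, hr.frame,
    hr.frame_mem⟩
  · have e1 : (τ₁ : ℝ) ≤ P.bound + 1 := by exact_mod_cast h₁
    have e2 : (τ₂ : ℝ) ≤ 3 * τ := by exact_mod_cast ht
    push_cast
    linarith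
  · simpa only [hr.mem] using hP

end WordRAM

/-! ### The SubsetSum instance -/

theorem exists_subset_range_sum_two_pow (L : ℕ) :
    ∀ d < 2 ^ L, ∃ S ⊆ Finset.range L, ∑ r ∈ S, 2 ^ r = d := by
  induction L with
  | zero => intro d hd; exact ⟨∅, by simp, by simp at hd; simp [hd]⟩
  | succ L ih =>
    intro d hd
    by_cases h : d < 2 ^ L
    · obtain ⟨S, hS, e⟩ := ih d h
      exact ⟨S, hS.trans (Finset.range_mono (by omega)), e⟩
    · obtain ⟨S, hS, e⟩ := ih (d - 2 ^ L) (by rw [pow_succ] at hd; omega)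
      refine ⟨insert L S, ?_, ?_⟩
      · intro x hx
        rcases Finset.mem_insert.1 hx with rfl | hx
        · simp
        · have := Finset.mem_range.1 (hS hx)
          simp; omega
      · rw [Finset.sum_insert (fun h' => by simpa using hS h'), e]
        omega

namespace MinConvInstance

variable (m L : ℕ) (A B C : ℕ → ℕ)

/-- The item for an entry of `A`: the leading part encodes the index. -/
def itemA (i : ℕ) : ℕ := (64 * m + i) * (8 * 2 ^ L) + A i
/-- The item for an entry of `B`. -/
def itemB (j : ℕ) : ℕ := (96 * m + j) * (8 * 2 ^ L) + B j
/-- The item for an entry of `C`, with index and value complemented. -/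
def itemC (l : ℕ) : ℕ := (114 * m - l) * (8 * 2 ^ L) + (2 ^ L - C l)

/-- The items of the instance: one for each entry of `A`, `B` and `C`, and powers of two that fill
gaps. -/
def items : List ℕ :=
  ((List.range m).map (itemA m L A)).reverse ++ ((List.range m).map (itemB m L B)).reverse ++
    ((List.range (2 * m)).map (itemC m L C)).reverse ++ ((List.range L).map (2 ^ ·)).reverse

/-- The target of the instance. -/
def target : ℕ := 274 * m * (8 * 2 ^ L) + (2 ^ L - 1)

theorem length_items : (items m L A B C).length = 4 * m + L := by
  simp [items]; ring

variable {m L A B C}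

/-- The low part is at most `2 ^ L`, far from a carry at `8 * 2 ^ L`. Division thus recovers the
leading part, by which items of different kinds are told apart. -/
theorem itemA_div (hA : ∀ i, A i ≤ 2 ^ L) (i : ℕ) : itemA m L A i / (8 * 2 ^ L) = 64 * m + i := by
  have h := hA i
  have h2 : 0 < 2 ^ L := by positivity
  rw [itemA, add_comm, Nat.add_mul_div_right _ _ (by positivity), Nat.div_eq_of_lt (by omega)]
  simp

theorem itemB_div (hB : ∀ i, B i ≤ 2 ^ L) (i : ℕ) : itemB m L B i / (8 * 2 ^ L) = 96 * m + i := by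
  have h := hB i
  have h2 : 0 < 2 ^ L := by positivity
  rw [itemB, add_comm, Nat.add_mul_div_right _ _ (by positivity), Nat.div_eq_of_lt (by omega)]
  simp

theorem itemC_div (l : ℕ) : itemC m L C l / (8 * 2 ^ L) = 114 * m - l := by
  have h2 : 0 < 2 ^ L := by positivity
  rw [itemC, add_comm, Nat.add_mul_div_right _ _ (by positivity), Nat.div_eq_of_lt (by omega)]
  simp

theorem two_pow_div {r : ℕ} (hr : r < L) : 2 ^ r / (8 * 2 ^ L) = 0 := by
  have : 2 ^ r < 2 ^ L := Nat.pow_lt_pow_right (by norm_num) hr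
  exact Nat.div_eq_of_lt (by omega)

theorem mem_items {x : ℕ} : x ∈ items m L A B C ↔ (∃ i < m, itemA m L A i = x) ∨
    (∃ i < m, itemB m L B i = x) ∨ (∃ l < 2 * m, itemC m L C l = x) ∨ ∃ r < L, 2 ^ r = x := by
  simp [items]

/-- The leading parts of the kinds lie in disjoint ranges: from `64 * m` to below `65 * m`, from `96
* m` to below `97 * m`, above `112 * m` up to `114 * m`, and zero for the powers of two.
Distinctness is essential because SubsetSum takes a set. -/
theorem nodup_items (hA : ∀ i, A i ≤ 2 ^ L) (hB : ∀ i, B i ≤ 2 ^ L) :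
    (items m L A B C).Nodup := by
  have key {l : List ℕ} {f : ℕ → ℕ} (hl : l.Nodup)
      (h : ∀ x ∈ l, ∀ y ∈ l, f x / (8 * 2 ^ L) = f y / (8 * 2 ^ L) → x = y) :
      (l.map f).reverse.Nodup := by
    rw [List.nodup_reverse]
    exact List.Nodup.map_on (fun x hx y hy e => h x hx y hy (by rw [e])) hl
  simp only [items, List.nodup_append, List.mem_append, List.mem_reverse, List.mem_map,
    List.mem_range]
  refine ⟨⟨⟨?_, ?_, ?_⟩, ?_, ?_⟩, ?_, ?_⟩
  · refine key List.nodup_range fun x _ y _ e => ?_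
    rw [itemA_div hA, itemA_div hA] at e; omega
  · refine key List.nodup_range fun x _ y _ e => ?_
    rw [itemB_div hB, itemB_div hB] at e; omega
  · rintro _ ⟨i, hi, rfl⟩ _ ⟨j, hj, rfl⟩ e
    have := congrArg (· / (8 * 2 ^ L)) e
    simp only [itemA_div hA, itemB_div hB] at this; omega
  · refine key List.nodup_range fun x hx y hy e => ?_
    rw [itemC_div, itemC_div] at e
    simp only [List.mem_range] at hx hy
    omega
  · rintro _ (⟨i, hi, rfl⟩ | ⟨i, hi, rfl⟩) _ ⟨j, hj, rfl⟩ e <;>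
      have := congrArg (· / (8 * 2 ^ L)) e <;>
      simp only [itemA_div hA, itemB_div hB, itemC_div] at this <;> omega
  · rw [List.nodup_reverse]
    exact List.nodup_range.map (Nat.pow_right_injective le_rfl)
  · rintro _ ((⟨i, hi, rfl⟩ | ⟨i, hi, rfl⟩) | ⟨i, hi, rfl⟩) _ ⟨j, hj, rfl⟩ e <;>
      have := congrArg (· / (8 * 2 ^ L)) e <;>
      simp only [itemA_div hA, itemB_div hB, itemC_div, two_pow_div hj] at this <;> omega

theorem items_pos_lt (hA : ∀ i, A i ≤ 2 ^ L) (hB : ∀ i, B i ≤ 2 ^ L) {x : ℕ}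
    (hx : x ∈ items m L A B C) : 0 < x ∧ x < (114 * m + 1) * (8 * 2 ^ L) := by
  have h2 : 0 < 2 ^ L := by positivity
  have aux {x h : ℕ} (e : x / (8 * 2 ^ L) = h) (h0 : 0 < h) (h1 : h ≤ 114 * m) :
      0 < x ∧ x < (114 * m + 1) * (8 * 2 ^ L) := by
    constructor
    · rcases Nat.eq_zero_or_pos x with rfl | h
      · simp at e; omega
      · exact h
    · rw [← Nat.div_lt_iff_lt_mul (by positivity), e]; omega
  rcases mem_items.1 hx with ⟨i, hi, rfl⟩ | ⟨i, hi, rfl⟩ | ⟨i, hi, rfl⟩ | ⟨i, hi, rfl⟩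
  · exact aux (itemA_div hA i) (by omega) (by omega)
  · exact aux (itemB_div hB i) (by omega) (by omega)
  · exact aux (itemC_div i) (by omega) (by omega)
  · refine ⟨by positivity, ?_⟩
    rw [← Nat.div_lt_iff_lt_mul (by positivity), two_pow_div hi]; omega

/-- If there are `i` and `j` with `A i + B j < C (i + j)`, then the target is attained. -/
theorem opt_eq_target (hA : ∀ i, A i ≤ 2 ^ L) (hB : ∀ i, B i ≤ 2 ^ L) {i j : ℕ} (hi : i < m)
    (hj : j < m) (hC : C (i + j) ≤ 2 ^ L) (h : A i + B j < C (i + j)) :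
    subsetSumOpt (items m L A B C).toFinset (target m L) = target m L := by
  have h2 : 0 < 2 ^ L := by positivity
  -- The low parts of the three items add up to `2 ^ L - (C (i + j) - A i - B j)`; this is what is
  -- missing to `2 ^ L - 1`, and it is nonnegative exactly because the inequality is strict.
  obtain ⟨S, hS, hsum⟩ := exists_subset_range_sum_two_pow L (C (i + j) - 1 - A i - B j) (by omega)
  set F := S.image (2 ^ ·) with hF
  have dF {x : ℕ} (hx : x ∈ F) : x / (8 * 2 ^ L) = 0 := by
    obtain ⟨r, hr, rfl⟩ := Finset.mem_image.1 hx
    exact two_pow_div (Finset.mem_range.1 (hS hr))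
  have dA := itemA_div (m := m) hA i
  have dB := itemB_div (m := m) hB j
  have dC := itemC_div (m := m) (L := L) (C := C) (i + j)
  set Y : Finset ℕ := insert (itemA m L A i) (insert (itemB m L B j)
    (insert (itemC m L C (i + j)) F)) with hY
  have hYsum : ∑ y ∈ Y, y = target m L := by
    rw [hY, Finset.sum_insert, Finset.sum_insert, Finset.sum_insert, hF, Finset.sum_image, hsum]
    · obtain ⟨d, hd⟩ : ∃ d, 114 * m = d + (i + j) := ⟨114 * m - (i + j), by omega⟩
      have e : 274 * m = (64 * m + i) + (96 * m + j) + d := by omega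
      have e' : 274 * m * (8 * 2 ^ L) = (64 * m + i) * (8 * 2 ^ L) + (96 * m + j) * (8 * 2 ^ L) +
        d * (8 * 2 ^ L) := by rw [e]; ring
      rw [itemA, itemB, itemC, target, hd, Nat.add_sub_cancel, e']
      omega
    · exact fun _ _ _ _ e => Nat.pow_right_injective le_rfl e
    · intro h; have := dF h; omega
    · simp only [Finset.mem_insert]
      rintro (h | h)
      · rw [← h, dB] at dC; omega
      · have := dF h; omega
    · simp only [Finset.mem_insert]
      rintro (h | h | h)
      · rw [h, dB] at dA; omega
      · rw [h, dC] at dA; omega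
      · have := dF h; omega
  refine le_antisymm (Finset.sup_le fun Z hZ => (Finset.mem_filter.1 hZ).2) ?_
  rw [← hYsum]
  refine Finset.le_sup (f := fun Y : Finset ℕ => ∑ y ∈ Y, y) (Finset.mem_filter.2 ⟨?_, le_rfl⟩)
  rw [Finset.mem_powerset]
  intro x hx
  rw [List.mem_toFinset, mem_items]
  simp only [hY, Finset.mem_insert, hF, Finset.mem_image] at hx
  rcases hx with rfl | rfl | rfl | ⟨r, hr, rfl⟩
  · exact .inl ⟨i, hi, rfl⟩
  · exact .inr (.inl ⟨j, hj, rfl⟩)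
  · exact .inr (.inr (.inl ⟨i + j, by omega, rfl⟩))
  · exact .inr (.inr (.inr ⟨r, Finset.mem_range.1 (hS hr), rfl⟩))

/-- As the list has no repetitions, the sum over `Y` is the sum of the list filtered by membership
in `Y`, and filtering respects the concatenation of the four kinds. -/
theorem sum_subset_items (hA : ∀ i, A i ≤ 2 ^ L) (hB : ∀ i, B i ≤ 2 ^ L) {Y : Finset ℕ}
    (hY : Y ⊆ (items m L A B C).toFinset) :
    ∃ SA ⊆ Finset.range m, ∃ SB ⊆ Finset.range m, ∃ SC ⊆ Finset.range (2 * m),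
      ∃ SF ⊆ Finset.range L, ∑ y ∈ Y, y = ∑ i ∈ SA, itemA m L A i + ∑ i ∈ SB, itemB m L B i +
        ∑ l ∈ SC, itemC m L C l + ∑ r ∈ SF, 2 ^ r := by
  have e1 : Y = ((items m L A B C).filter (· ∈ Y)).toFinset := by
    ext x
    simp only [List.mem_toFinset, List.mem_filter, decide_eq_true_eq]
    exact ⟨fun h => ⟨List.mem_toFinset.1 (hY h), h⟩, fun h => h.2⟩
  have aux (n : ℕ) (f : ℕ → ℕ) : ((((List.range n).map f).reverse).filter (· ∈ Y)).sum =
      ∑ i ∈ (Finset.range n).filter (fun i => f i ∈ Y), f i := by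
    rw [List.filter_reverse, List.sum_reverse, List.filter_map]
    induction n with
    | zero => simp
    | succ n ih =>
      rw [List.range_succ, List.filter_append, List.map_append, List.sum_append, ih,
        Finset.range_add_one, Finset.filter_insert]
      by_cases h : f n ∈ Y
      · simp [h, add_comm]
      · simp [h]
  refine ⟨(Finset.range m).filter fun i => itemA m L A i ∈ Y, Finset.filter_subset _ _,
    (Finset.range m).filter fun i => itemB m L B i ∈ Y, Finset.filter_subset _ _,
    (Finset.range (2 * m)).filter fun i => itemC m L C i ∈ Y, Finset.filter_subset _ _,
    (Finset.range L).filter fun i => 2 ^ i ∈ Y, Finset.filter_subset _ _, ?_⟩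
  rw [← aux, ← aux, ← aux, ← aux L (2 ^ ·), ← List.sum_append, ← List.sum_append,
    ← List.sum_append, ← List.filter_append, ← List.filter_append, ← List.filter_append]
  conv_lhs => rw [e1]
  rw [List.sum_toFinset (fun x => x) ((nodup_items hA hB).filter _), List.map_id']
  rfl

theorem sum_two_pow_lt {S : Finset ℕ} (hS : S ⊆ Finset.range L) : ∑ r ∈ S, 2 ^ r < 2 ^ L := by
  refine (Finset.sum_le_sum_of_subset hS).trans_lt ?_
  rw [Nat.geomSum_eq le_rfl]
  have h2 : 0 < 2 ^ L := by positivity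
  omega

/-- Writing the number of chosen items of the three kinds as `x`, `y`, `z`: only `x = y = z = 1`
gives the right leading part. -/
theorem counts_eq_one {m x y z P Q R : ℕ} (hm : 0 < m) (hP : P ≤ x * m) (hQ : Q ≤ y * m)
    (hR : 112 * m * z ≤ R) (hR' : R ≤ 114 * m * z)
    (h : 64 * m * x + P + (96 * m * y + Q) + R = 274 * m) : x = 1 ∧ y = 1 ∧ z = 1 := by
  -- Dividing by `m` leaves two inequalities, from the smallest and the largest possible leading
  -- parts. Among the finitely many triples satisfying the first, only `(1, 1, 1)` satisfies both.
  have h1 : 64 * x + 96 * y + 112 * z ≤ 274 := by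
    by_contra hc
    have : 275 * m ≤ (64 * x + 96 * y + 112 * z) * m := Nat.mul_le_mul_right _ (by omega)
    nlinarith
  have h2 : 274 ≤ 65 * x + 97 * y + 114 * z := by
    by_contra hc
    have : (65 * x + 97 * y + 114 * z) * m ≤ 273 * m := Nat.mul_le_mul_right _ (by omega)
    nlinarith
  clear h hP hQ hR hR'
  have hx : x ≤ 4 := by omega
  have hy : y ≤ 2 := by omega
  have hz : z ≤ 2 := by omega
  interval_cases y <;> interval_cases z <;> omega

/-- If there are no such `i` and `j`, then the optimum stays far below the target. -/
theorem opt_lt_target (hm : 0 < m) (hA : ∀ i, A i ≤ 2 ^ L) (hB : ∀ i, B i ≤ 2 ^ L)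
    (h : ∀ i < m, ∀ j < m, C (i + j) ≤ A i + B j) :
    subsetSumOpt (items m L A B C).toFinset (target m L) + 3 * 2 ^ L ≤ 274 * m * (8 * 2 ^ L) := by
  have h2 : 0 < 2 ^ L := by positivity
  suffices hs : subsetSumOpt (items m L A B C).toFinset (target m L) ≤
      274 * m * (8 * 2 ^ L) - 3 * 2 ^ L by
    have : 1 * (8 * 2 ^ L) ≤ 274 * m * (8 * 2 ^ L) := Nat.mul_le_mul_right _ (by omega)
    omega
  refine Finset.sup_le fun Y hY => ?_
  obtain ⟨hY, hle⟩ := Finset.mem_filter.1 hY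
  obtain ⟨SA, hSA, SB, hSB, SC, hSC, SF, hSF, e⟩ :=
    sum_subset_items hA hB (Finset.mem_powerset.1 hY)
  simp only [itemA, itemB, itemC, Finset.sum_add_distrib, ← Finset.sum_mul] at e
  rw [Finset.sum_add_distrib, Finset.sum_add_distrib, Finset.sum_const, Finset.sum_const,
    smul_eq_mul, smul_eq_mul] at e
  have hF := sum_two_pow_lt hSF
  have hP : ∑ i ∈ SA, i ≤ SA.card * m :=
    Finset.sum_le_card_nsmul _ _ _ fun i hi => (Finset.mem_range.1 (hSA hi)).le
  have hQ : ∑ i ∈ SB, i ≤ SB.card * m :=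
    Finset.sum_le_card_nsmul _ _ _ fun i hi => (Finset.mem_range.1 (hSB hi)).le
  have hR : SC.card * (112 * m) ≤ ∑ l ∈ SC, (114 * m - l) :=
    Finset.card_nsmul_le_sum _ _ _ fun i hi => by have := Finset.mem_range.1 (hSC hi); omega
  have hR' : ∑ l ∈ SC, (114 * m - l) ≤ SC.card * (114 * m) :=
    Finset.sum_le_card_nsmul _ _ _ fun i hi => by omega
  have lA : ∑ i ∈ SA, A i ≤ SA.card * 2 ^ L := Finset.sum_le_card_nsmul _ _ _ fun i _ => hA i
  have lB : ∑ i ∈ SB, B i ≤ SB.card * 2 ^ L := Finset.sum_le_card_nsmul _ _ _ fun i _ => hB i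
  have lC : ∑ i ∈ SC, (2 ^ L - C i) ≤ SC.card * 2 ^ L :=
    Finset.sum_le_card_nsmul _ _ _ fun i _ => by omega
  set P := ∑ i ∈ SA, i
  set Q := ∑ i ∈ SB, i
  set R := ∑ l ∈ SC, (114 * m - l)
  set a := ∑ i ∈ SA, A i with ha
  set b := ∑ i ∈ SB, B i with hb
  set c := ∑ l ∈ SC, (2 ^ L - C l) with hc
  set f := ∑ r ∈ SF, 2 ^ r
  set D := 2 ^ L
  set H := SA.card * (64 * m) + P + (SB.card * (96 * m) + Q) + R with hH
  have e' : ∑ y ∈ Y, y = H * (8 * D) + (a + b + c + f) := by rw [e, hH]; ring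
  rw [e'] at hle
  change _ ≤ 274 * m * (8 * D) + (D - 1) at hle
  change _ ≤ 274 * m * (8 * D) - 3 * D
  rw [e']
  have hH1 : H ≤ 274 * m := by
    by_contra hcon
    have : (274 * m + 1) * (8 * D) ≤ H * (8 * D) := Nat.mul_le_mul_right _ (by omega)
    rw [add_mul] at this
    omega
  -- Every item other than a power of two has leading part at least `64 * m`, and five of them would
  -- exceed `274 * m`.
  have hcard : SA.card + SB.card + SC.card ≤ 4 := by
    by_contra hcon
    have : 5 * m ≤ (SA.card + SB.card + SC.card) * m := Nat.mul_le_mul_right _ (by omega)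
    nlinarith
  -- A leading part that is too small loses `8 * D`, while four low parts and the powers of two
  -- regain less than `5 * D`. An exact leading part forces `l = i + j` and a low part of at least
  -- `D`, which overshoots the target.
  rcases hH1.lt_or_eq with hlt | heq
  · have h1 : (H + 1) * (8 * D) ≤ 274 * m * (8 * D) := Nat.mul_le_mul_right _ (by omega)
    have h3 : (SA.card + SB.card + SC.card) * D ≤ 4 * D := Nat.mul_le_mul_right _ hcard
    rw [add_mul] at h1
    rw [add_mul, add_mul] at h3
    omega
  · exfalso
    obtain ⟨hx, hy, hz⟩ := counts_eq_one hm hP hQ (by linarith) (by linarith)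
      (x := SA.card) (y := SB.card) (z := SC.card) (R := R) (by rw [← heq, hH]; ring)
    obtain ⟨i, rfl⟩ := Finset.card_eq_one.1 hx
    obtain ⟨j, rfl⟩ := Finset.card_eq_one.1 hy
    obtain ⟨l, rfl⟩ := Finset.card_eq_one.1 hz
    simp only [P, Q, R, Finset.card_singleton, Finset.sum_singleton] at hH
    simp only [Finset.sum_singleton] at ha hb hc
    simp only [Finset.singleton_subset_iff, Finset.mem_range] at hSA hSB hSC
    rw [heq] at hle
    have hl : l = i + j := by omega
    have := h i hSA j hSB
    rw [hl] at hc
    omega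

/-- The number 1096 is chosen so that the fraction `1 / (1096 * m)` of the leading term `274 * m *
(8 * 2 ^ L)` is `2 * 2 ^ L`. The deficit of `3 * 2 ^ L` below that term beats this. -/
theorem opt_lt_gap (hm : 0 < m) (hA : ∀ i, A i ≤ 2 ^ L) (hB : ∀ i, B i ≤ 2 ^ L)
    (h : ∀ i < m, ∀ j < m, C (i + j) ≤ A i + B j) :
    (subsetSumOpt (items m L A B C).toFinset (target m L) : ℝ) <
      (1 - 1 / ((1096 * m : ℕ) : ℝ)) * (target m L : ℝ) := by
  have h1 : ((subsetSumOpt (items m L A B C).toFinset (target m L) + 3 * 2 ^ L : ℕ) : ℝ) ≤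
    ((274 * m * (8 * 2 ^ L) : ℕ) : ℝ) := by exact_mod_cast opt_lt_target hm hA hB h
  have ht : (target m L : ℝ) = 274 * m * (8 * 2 ^ L) + (2 ^ L - 1) := by
    rw [target, Nat.cast_add, Nat.cast_sub Nat.one_le_two_pow]; push_cast; ring
  have hV : (1 : ℝ) ≤ 2 ^ L := one_le_pow₀ (by norm_num)
  have hm' : (1 : ℝ) ≤ m := by exact_mod_cast hm
  rw [ht]
  push_cast at h1 ⊢
  have e : (1 - 1 / (1096 * (m : ℝ))) * (274 * m * (8 * 2 ^ L) + (2 ^ L - 1)) =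
      274 * m * (8 * 2 ^ L) + (2 ^ L - 1) - 2 * 2 ^ L - (2 ^ L - 1) / (1096 * m) := by
    field_simp; ring
  have h3 : ((2 : ℝ) ^ L - 1) / (1096 * m) ≤ 2 ^ L - 1 :=
    div_le_self (by linarith) (by linarith)
  rw [e]
  linarith

end MinConvInstance

/-! ### Decision subroutines from either kind of solver -/

namespace WordRAM

/-- The program `Q` decides, within `T` steps, the GapSubsetSum instance `X`, `t`, `1 / q` that
stands in the memory cells `off, S + off, 2 * S + off, …`, where `S` and `off` are given by the
registers `7` and `8`; the answer is found in register `32`. -/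
def DecidesGap (w T : ℕ) (Q : Prog) (X : List ℕ) (t q S : ℕ) : Prop :=
  subsetSumOpt X.toFinset t = t ∨
    (subsetSumOpt X.toFinset t : ℝ) < (1 - 1 / (q : ℝ)) * (t : ℝ) →
  ∀ s : State, s.reg 8 < S → s.reg 0 = 0 → s.reg 1 = 1 → s.reg 7 = S → s.reg 18 = t →
    s.reg 19 = q →
    (∀ a, s.mem (a * S + s.reg 8) = (X.length :: t :: 1 :: q :: X).getD a 0) →
    WP w Q (fun τ s' => τ ≤ T ∧ (∀ r < 32, s'.reg r = s.reg r) ∧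
      (∀ x, (∀ a, x ≠ a * S + s.reg 8) → s'.mem x = s.mem x) ∧
      (s'.reg 32 ≠ 0 ↔ subsetSumOpt X.toFinset t = t)) s

/-- Valid inputs with `ε = 1 / q`. -/
structure ValidGapInput (c : ℕ) (X : List ℕ) (t q : ℕ) : Prop where
  nodup : X.Nodup
  bound : ∀ x ∈ X, 0 < x ∧ x < 2 ^ (c * (X.length + q).size)
  t_pos : 0 < t
  t_lt : t < 2 ^ (c * (X.length + q).size)
  one_lt : 1 < q
  q_lt : q < 2 ^ (c * (X.length + q).size)

/-- GapSubsetSum instances can be decided by a subroutine in time `O(T(n, q) + n)`. -/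
def HasGapSubroutine (T : ℕ → ℝ → ℝ) : Prop :=
  ∀ c : ℕ, ∃ (Q : Prog) (κ : ℕ) (K : ℝ), 0 ≤ K ∧ ∀ (X : List ℕ) (t q : ℕ), ValidGapInput c X t q →
    ∀ w S : ℕ, 0 < S → 2 ^ (κ * (X.length + q).size) * S ≤ 2 ^ w →
      DecidesGap w ⌊K * (T X.length q + X.length + 1)⌋₊ Q X t q S

theorem ValidGapInput.halts {Out : Finset ℕ → ℕ → ℝ → (ℕ → ℕ) → Prop} {T : ℕ → ℝ → ℝ} {c : ℕ}
    {P : Prog} {κ : ℕ} {K : ℝ}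
    (h : ∀ (X : List ℕ) (t p q : ℕ),
    X.Nodup → (∀ x ∈ X, 0 < x ∧ x < 2 ^ (c * (X.length + q / p).size)) →
    0 < t → t < 2 ^ (c * (X.length + q / p).size) →
    0 < p → p < q → q < 2 ^ (c * (X.length + q / p).size) →
    WordRAM.HaltsWithin (κ * (X.length + q / p).size) P (X.length :: t :: p :: q :: X)
      (K * T X.length ((q : ℝ) / (p : ℝ))) (Out X.toFinset t ((p : ℝ) / (q : ℝ))))
    {X : List ℕ} {t q : ℕ} (hv : ValidGapInput c X t q) :
    HaltsWithin (κ * (X.length + q).size) P (X.length :: t :: 1 :: q :: X)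
      (K * T X.length q) (Out X.toFinset t (1 / q)) := by
  have := h X t 1 q hv.nodup (by simpa using hv.bound) hv.t_pos (by simpa using hv.t_lt)
    one_pos hv.one_lt (by simpa using hv.q_lt)
  simpa using this

theorem addr_lt {w k S off x : ℕ} (h : 2 ^ k * S ≤ 2 ^ w) (hoff : off < S) (hx : x < 2 ^ k) :
    x * S + off < 2 ^ w := by
  have : (x + 1) * S ≤ 2 ^ k * S := Nat.mul_le_mul_right _ hx
  rw [add_mul] at this
  omega

theorem le_of_two_pow_mul_le {w k S : ℕ} (h : 2 ^ k * S ≤ 2 ^ w) (hS : 0 < S) : k ≤ w := by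
  by_contra hc
  have h1 : 2 ^ w < 2 ^ k := Nat.pow_lt_pow_right (by norm_num) (by omega)
  have h2 := Nat.le_mul_of_pos_right (2 ^ k) hS
  omega

theorem hasGapSubroutine_of_gap {T : ℕ → ℝ → ℝ} (hT : ∀ n r, 0 ≤ r → 0 ≤ T n r)
    (h : GapSubsetSumInTime T) : HasGapSubroutine T := by
  intro c
  obtain ⟨P, κ, K, h⟩ := h c
  -- The extra 1 in the word size lets the answer `1` fit into a register even if `κ = 0`.
  refine ⟨.seq P.call (.load 32 8), κ + 1, 3 * |K| + (P.bound + 2), by positivity, ?_⟩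
  intro X t q hv w S hS hw hpromise s h8 h0 h1 h7 h18 h19 hmem
  set N := (X.length + q).size with hN
  have hw' : 2 ^ (κ * N) * S ≤ 2 ^ w :=
    (Nat.mul_le_mul_right _ (Nat.pow_le_pow_right (by norm_num)
      (Nat.mul_le_mul_right _ (by omega)))).trans hw
  have hcall := (hv.halts h).call hS (le_of_two_pow_mul_le hw' hS)
    (fun x hx => addr_lt hw' h8 hx) h7 rfl hmem
  refine hcall.seq fun τ s₁ ⟨hτ, hout, hreg, hfr⟩ => ?_
  rw [wp_load, hreg 8 (by norm_num)]
  simp only [IsGapSubsetSumOutput, zero_mul, zero_add] at hout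
  -- The promise is needed already for loading the answer: an arbitrary output cell might not fit
  -- into a word.
  have hv1 : s₁.mem (s.reg 8) < 2 ^ w := by
    have h1w : 1 < 2 ^ w := by
      have h2 : X.length + q < 2 ^ N := Nat.lt_size_self _
      have h3 := hv.one_lt
      have h4 : 2 ^ N ≤ 2 ^ w := Nat.pow_le_pow_right (by norm_num)
        ((Nat.le_mul_of_pos_left N (by omega)).trans (le_of_two_pow_mul_le hw hS))
      omega
    rcases hpromise with hp | hp
    · rw [hout.1 hp]; exact h1w
    · rw [hout.2 hp]; positivity
  refine ⟨hv1, ?_, fun r hr => ?_, hfr, ?_⟩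
  · refine Nat.le_floor ?_
    have h2 : K * T X.length q ≤ |K| * T X.length q :=
      mul_le_mul_of_nonneg_right (le_abs_self K) (hT _ _ q.cast_nonneg)
    have h3 := hT X.length q q.cast_nonneg
    have h4 : (0 : ℝ) ≤ P.bound := by positivity
    have h5 : (0 : ℝ) ≤ X.length := by positivity
    push_cast
    nlinarith [abs_nonneg K, mul_nonneg (abs_nonneg K) h5, mul_nonneg h4 h5, mul_nonneg h4 h3]
  · simpa [show r ≠ 32 by omega] using hreg r (by omega)
  · simp only [State.setReg_reg, if_true]
    constructor
    · intro h
      rcases hpromise with hp | hp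
      · exact hp
      · exact absurd (hout.2 hp) h
    · intro hp
      rw [hout.1 hp]; norm_num

/-- Sum the elements of the output of an approximation scheme, and compare the sum `σ` with the
target `t`: the answer is whether `(q - 1) * t ≤ q * σ`. -/
def compareSum : Prog :=
  .seq (.load 34 8) <| .seq (.const 35 0) <|
  .seq (forDown 38 34 (.seq (.op .add 37 38 1) <| .seq (.op .mul 37 37 7) <|
    .seq (.op .add 37 37 8) <| .seq (.load 37 37) (.op .add 35 35 37))) <|
  .seq (.op .mul 35 35 19) <| .seq (.op .sub 37 19 1) <| .seq (.op .mul 37 37 18) <|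
  .seq (.op .lt 32 35 37) (.op .eq 32 32 0)

/-- Overflow is excluded by `hsum`: all partial sums are at most `t`, and both products in the final
comparison are at most `q * t`. -/
theorem wp_compareSum {w k S t q : ℕ} {Y : List ℕ} {s : State} (hS : 0 < S)
    (hw : 2 ^ k * S ≤ 2 ^ w) (hqt : q * t < 2 ^ k) (hq : q < 2 ^ k) (ht : t < 2 ^ k)
    (hY : Y.length + 1 < 2 ^ k)
    (h8 : s.reg 8 < S) (h0 : s.reg 0 = 0)
    (h1 : s.reg 1 = 1) (h7 : s.reg 7 = S) (h18 : s.reg 18 = t) (h19 : s.reg 19 = q)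
    (hm0 : s.mem (s.reg 8) = Y.length)
    (hm : ∀ (i : ℕ) (h : i < Y.length), s.mem ((i + 1) * S + s.reg 8) = Y[i])
    (hsum : Y.sum ≤ t) :
    WP w compareSum (fun τ s' => τ ≤ 7 * Y.length + 10 ∧ (∀ r < 32, s'.reg r = s.reg r) ∧
      s'.mem = s.mem ∧ (s'.reg 32 ≠ 0 ↔ (q - 1) * t ≤ q * Y.sum)) s := by
  have hkw : 2 ^ k ≤ 2 ^ w := Nat.pow_le_pow_right (by norm_num) (le_of_two_pow_mul_le hw hS)
  have haddr {x : ℕ} (hx : x < 2 ^ k) := addr_lt hw h8 hx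
  simp only [compareSum, wp_seq (P := .load _ _), wp_seq (P := .const _ _), wp_load, wp_const, hm0]
  refine ⟨by omega, by omega, ?_⟩
  refine WP.seq (WP.forDown (fun k s' => (∀ r < 32, s'.reg r = s.reg r) ∧ s'.mem = s.mem ∧
    s'.reg 34 = Y.length ∧ s'.reg 35 = (Y.drop k).sum) (fun _ => 0) 5
    (fun k s' h => ⟨(h.1 0 (by norm_num)).trans h0, (h.1 1 (by norm_num)).trans h1⟩)
    (fun k s' x h => ⟨fun r hr => ?_, h.2.1, ?_, ?_⟩) ?_ ?_ ⟨fun r hr => ?_, rfl, ?_, ?_⟩) ?_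
  · simpa [show r ≠ 38 by omega] using h.1 r hr
  · simpa using h.2.2.1
  · simpa using h.2.2.2
  · simp; omega
  · simp only [State.setReg_reg]
    rintro i hi s₁ hs₁ ⟨hr, hmem, h34, h35⟩
    have hi' : i < Y.length := by simpa using hi
    have e : (Y.drop i).sum = Y[i] + (Y.drop (i + 1)).sum := by
      rw [List.drop_eq_getElem_cons hi', List.sum_cons]
    have hle : (Y.drop i).sum ≤ Y.sum := (List.drop_sublist i Y).sum_le_sum (by simp)
    have ha := haddr (show i + 1 < 2 ^ k by omega)
    simp [Op.eval, hs₁, hr 1, hr 7, hr 8, h1, h7, hmem, hm i hi', h34, h35]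
    refine ⟨by omega, by omega, ha, by omega, by omega, fun r hr' => ?_, ?_⟩
    · simp [show r ≠ 35 by omega, show r ≠ 37 by omega, hr r hr']
    · omega
  · simp [show r ≠ 34 by omega, show r ≠ 35 by omega]
  · simp
  · simp
  · rintro τ s₁ ⟨⟨hr, hmem, h34, h35⟩, hτ⟩
    have e1 : Y.sum * q ≤ q * t := by rw [mul_comm]; exact Nat.mul_le_mul_left _ hsum
    have e2 : (q - 1) * t ≤ q * t := Nat.mul_le_mul_right _ (by omega)
    have h1k : 1 < 2 ^ k := by omega
    simp at hτ
    simp [Op.eval, hr 19, hr 1, hr 18, hr 0, h0, h1, h18, h19, h35, mul_comm Y.sum q]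
    rw [mul_comm] at e1
    have h2 : ∀ b : Prop, ∀ [Decidable b], (if b then 1 else 0) < 2 ^ w := fun b _ => by
      split <;> omega
    refine ⟨by omega, by omega, by omega, h2 _, h2 _, by omega, fun r hr' => ?_, hmem⟩
    simp [show r ≠ 32 by omega, show r ≠ 35 by omega, show r ≠ 37 by omega, hr r hr']

/-- If `OPT = t`, the scheme returns a sum of at least `(1 - ε) * t`; otherwise the promise gives
`Σ(Y) ≤ OPT < (1 - ε) * t`. Comparing with `(1 - ε) * t`, cleared of the denominator `q`, therefore
decides the instance. Adding up the output accounts for the linear term in `HasGapSubroutine`. -/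
theorem hasGapSubroutine_of_approx {T : ℕ → ℝ → ℝ} (hT : ∀ n r, 0 ≤ r → 0 ≤ T n r)
    (h : SubsetSumApproxSchemeInTime T) : HasGapSubroutine T := by
  intro c
  obtain ⟨P, κ, K, h⟩ := h c
  -- The summand `2 * c` makes room for the product `q * t`, and 1 for the length of the output.
  refine ⟨.seq P.call compareSum, κ + 2 * c + 1, 3 * |K| + (P.bound + 11), by positivity, ?_⟩
  intro X t q hv w S hS hw hpromise s h8 h0 h1 h7 h18 h19 hmem
  set N := (X.length + q).size with hN
  have hNpos : X.length + q < 2 ^ N := Nat.lt_size_self _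
  have hw' : 2 ^ (κ * N) * S ≤ 2 ^ w :=
    (Nat.mul_le_mul_right _ (Nat.pow_le_pow_right (by norm_num)
      (Nat.mul_le_mul_right _ (by omega)))).trans hw
  have hcall := (hv.halts h).call hS (le_of_two_pow_mul_le hw' hS)
    (fun x hx => addr_lt hw' h8 hx) h7 rfl hmem
  refine hcall.seq fun τ s₁ ⟨hτ, hout, hreg, hfr⟩ => ?_
  obtain ⟨Y, hYn, hYX, hY0, hYi, hYlow, hYup⟩ := hout
  have hq := hv.one_lt
  have hopt : subsetSumOpt X.toFinset t ≤ t :=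
    Finset.sup_le fun Z hZ => (Finset.mem_filter.1 hZ).2
  have hlen : Y.length ≤ X.length := by
    rw [← List.toFinset_card_of_nodup hYn, ← List.toFinset_card_of_nodup hv.nodup]
    exact Finset.card_le_card hYX
  have hpow {a : ℕ} (ha : a ≤ κ + 2 * c + 1) : 2 ^ (a * N) ≤ 2 ^ ((κ + 2 * c + 1) * N) :=
    Nat.pow_le_pow_right (by norm_num) (Nat.mul_le_mul_right _ ha)
  have hpow1 := hpow (a := 1) (by omega)
  rw [one_mul] at hpow1
  have hs8 := hreg 8 (by norm_num)
  refine (wp_compareSum (w := w) (k := (κ + 2 * c + 1) * N) (S := S) (t := t) (q := q) (Y := Y)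
    hS hw ?_ (hv.q_lt.trans_le (hpow (by omega))) (hv.t_lt.trans_le (hpow (by omega))) (by omega) (by rwa [hs8])
    ((hreg 0 (by norm_num)).trans h0) ((hreg 1 (by norm_num)).trans h1)
    ((hreg 7 (by norm_num)).trans h7) ((hreg 18 (by norm_num)).trans h18)
    ((hreg 19 (by norm_num)).trans h19) (by simpa [hs8] using hY0)
    (by simpa [hs8] using hYi) (hYup.trans hopt)).mono ?_
  · refine lt_of_lt_of_le ?_ (hpow (a := c + c) (by omega))
    rw [add_mul, pow_add]
    exact Nat.mul_lt_mul'' hv.q_lt hv.t_lt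
  · rintro τ₂ s₂ ⟨hτ₂, hr₂, hm₂, h32⟩
    refine ⟨?_, fun r hr => (hr₂ r hr).trans (hreg r (by omega)), fun x hx => ?_, ?_⟩
    · refine Nat.le_floor ?_
      have h2 : K * T X.length q ≤ |K| * T X.length q :=
        mul_le_mul_of_nonneg_right (le_abs_self K) (hT _ _ q.cast_nonneg)
      have h3 := hT X.length q q.cast_nonneg
      have h4 : (0 : ℝ) ≤ P.bound := by positivity
      have h5 : (0 : ℝ) ≤ X.length := by positivity
      have h6 : (τ₂ : ℝ) ≤ 7 * X.length + 10 := by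
        exact_mod_cast hτ₂.trans (by omega)
      push_cast
      nlinarith [abs_nonneg K, mul_nonneg (abs_nonneg K) h5, mul_nonneg h4 h5, mul_nonneg h4 h3]
    · rw [hm₂, hfr x hx]
    · rw [h32]
      have hq' : (0 : ℝ) < q := by exact_mod_cast (by omega : 0 < q)
      have ht' : (0 : ℝ) < t := by exact_mod_cast hv.t_pos
      have hiff : (q - 1) * t ≤ q * Y.sum ↔ (1 - 1 / (q : ℝ)) * t ≤ Y.sum := by
        rw [← Nat.cast_le (α := ℝ)]
        rw [Nat.cast_mul, Nat.cast_mul, Nat.cast_sub hq.le, Nat.cast_one]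
        rw [show (1 - 1 / (q : ℝ)) * t = ((q - 1) * t) / q by field_simp,
          div_le_iff₀ hq', mul_comm (Y.sum : ℝ)]
      rw [hiff]
      constructor
      · intro h
        rcases hpromise with hp | hp
        · exact hp
        · have : (Y.sum : ℝ) ≤ (subsetSumOpt X.toFinset t : ℝ) := by exact_mod_cast hYup
          linarith
      · intro hp
        rwa [hp] at hYlow


/-! ### The subroutine that treats one pair of blocks

Registers: `0` and `1` hold the constants `0` and `1`; `2`: `n`; `3`: `v`; `5`: `m`; `6`: `g`;
`7`: `S`; `8`: first cell of the memory region for the next call; `9`: `2 ^ L`; `10`, `11`, `12`: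
first cells of `A`, `B`, `E`; `13`: step width; `14`: number of the block pair; `15`, `16`: offsets
of the blocks; `17` to `27`: further constants; from `32` on: scratch. -/

/-- The registers that hold constants. -/
structure Consts (n v m L S : ℕ) (s : State) : Prop where
  r0 : s.reg 0 = 0
  r1 : s.reg 1 = 1
  r2 : s.reg 2 = n
  r3 : s.reg 3 = v
  r5 : s.reg 5 = m
  r6 : s.reg 6 = m ^ 2
  r7 : s.reg 7 = S
  r9 : s.reg 9 = 2 ^ L
  r10 : s.reg 10 = 4 * v
  r11 : s.reg 11 = 5 * v
  r12 : s.reg 12 = 6 * v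
  r17 : s.reg 17 = 4 * m + L
  r18 : s.reg 18 = MinConvInstance.target m L
  r19 : s.reg 19 = 1096 * m
  r20 : s.reg 20 = 8 * 2 ^ L
  r21 : s.reg 21 = 64 * m
  r22 : s.reg 22 = 96 * m
  r23 : s.reg 23 = 114 * m
  r24 : s.reg 24 = 2 * m
  r25 : s.reg 25 = 2
  r26 : s.reg 26 = m ^ 4
  r27 : s.reg 27 = 2 * v

theorem Consts.congr {n v m L S : ℕ} {s s' : State} (h : Consts n v m L S s)
    (hr : ∀ r < 32, r ≠ 8 → ¬ (13 ≤ r ∧ r ≤ 16) → s'.reg r = s.reg r) : Consts n v m L S s' := by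
  constructor <;> rw [hr _ (by norm_num) (by norm_num) (by norm_num)]
  exacts [h.r0, h.r1, h.r2, h.r3, h.r5, h.r6, h.r7, h.r9, h.r10, h.r11, h.r12, h.r17, h.r18, h.r19,
    h.r20, h.r21, h.r22, h.r23, h.r24, h.r25, h.r26, h.r27]

/-- The arrays `A`, `B`, `E` in memory; the regions for further calls are empty. -/
structure Arrays (v S : ℕ) (A B E : ℕ → ℕ) (s : State) : Prop where
  memA : ∀ i < v, s.mem (4 * v + i) = A i
  memB : ∀ i < v, s.mem (5 * v + i) = B i
  memE : ∀ k < 2 * v, s.mem (6 * v + k) = E k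
  off_ge : 8 * v ≤ s.reg 8
  fresh : ∀ j, s.reg 8 ≤ j → j < S → ∀ a, s.mem (a * S + j) = 0

/-- Bounds on the word size. -/
structure WordBounds (w v m L S : ℕ) : Prop where
  m_pos : 0 < m
  v_le : 8 * v ≤ S
  S_le : (4 * m + L + 6) * S ≤ 2 ^ w
  items_le : 2 ^ 12 * m * 2 ^ L ≤ 2 ^ w

/-! ### Writing a SubsetSum instance into a memory region -/

/-- The memory cells `off, S + off, …` are being filled: up to now they hold the list `l`, and
register `33` holds the address of the next one. -/
structure Building (s₀ : State) (S : ℕ) (l : List ℕ) (s : State) : Prop where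
  reg : ∀ r < 32, s.reg r = s₀.reg r
  frame : ∀ x, (∀ a, x ≠ a * S + s₀.reg 8) → s.mem x = s₀.mem x
  holds : ∀ a, s.mem (a * S + s₀.reg 8) = l.getD a 0
  ptr : s.reg 33 = l.length * S + s₀.reg 8

theorem Building.setReg {s₀ : State} {S : ℕ} {l : List ℕ} {s : State} (h : Building s₀ S l s)
    {r : ℕ} (hr : 34 ≤ r) (x : ℕ) : Building s₀ S l (s.setReg r x) := by
  refine ⟨fun r' hr' => ?_, h.frame, h.holds, ?_⟩
  · simpa [show r' ≠ r by omega] using h.reg r' hr'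
  · simpa [show 33 ≠ r by omega] using h.ptr

theorem Building.mem_of_lt {s₀ : State} {S : ℕ} {l : List ℕ} {s : State} (h : Building s₀ S l s)
    {x : ℕ} (hx : x < s₀.reg 8) : s.mem x = s₀.mem x :=
  h.frame x fun a => by omega

/-- Append `R[r]` to the list that is being built. -/
def push (r : ℕ) : Prog := .seq (.store 33 r) (.op .add 33 33 7)

theorem wp_push {w S r : ℕ} {s₀ s : State} {l : List ℕ} (h : Building s₀ S l s) (hS : 0 < S)
    (h7 : s₀.reg 7 = S) (hw : (l.length + 1) * S + s₀.reg 8 < 2 ^ w) :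
    WP w (push r) (fun τ s' => τ = 2 ∧ Building s₀ S (l ++ [s.reg r]) s' ∧
      ∀ r', r' ≠ 33 → s'.reg r' = s.reg r') s := by
  have e7 : s.reg 7 = S := (h.reg 7 (by norm_num)).trans h7
  have e : l.length * S + s₀.reg 8 + S = (l.length + 1) * S + s₀.reg 8 := by ring
  simp only [push, wp_seq, wp_store, wp_op, Op.eval, State.setMem_reg, h.ptr, e7, e]
  refine ⟨hw, by norm_num, ⟨fun r' hr' => ?_, fun x hx => ?_, fun a => ?_, by simp⟩,
    fun r' hr' => by simp [hr']⟩
  · simpa [show r' ≠ 33 by omega] using h.reg r' hr'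
  · simpa [hx l.length] using h.frame x hx
  · simp only [State.setReg_mem, State.setMem_mem, add_left_inj, Nat.mul_right_cancel_iff hS,
      h.holds]
    rcases lt_trichotomy a l.length with ha | rfl | ha
    · simp [ha.ne, List.getD_eq_getElem?_getD, List.getElem?_append_left ha]
    · simp [List.getD_eq_getElem?_getD]
    · rw [if_neg ha.ne', List.getD_eq_default _ _ ha.le, List.getD_eq_default]
      simp; omega

theorem map_range'_reverse (f : ℕ → ℕ) {k N : ℕ} (hk : k < N) :
    ((List.range' k (N - k)).map f).reverse =
      ((List.range' (k + 1) (N - (k + 1))).map f).reverse ++ [f k] := by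
  rw [show N - k = N - (k + 1) + 1 by omega, List.range'_succ]
  simp

/-- The counter runs downwards, so the values appear in reversed order; the reversals in `items`
match this. -/
theorem wp_forDown_push {w S N T : ℕ} {s₀ s : State} {l : List ℕ} {body : Prog} (f : ℕ → ℕ)
    (h0 : s₀.reg 0 = 0) (h1 : s₀.reg 1 = 1) (hN : N < 32) (hNw : s₀.reg N < 2 ^ w)
    (h : Building s₀ S l s)
    (hbody : ∀ k < s₀.reg N, ∀ l' s₁, l'.length < l.length + s₀.reg N → s₁.reg 34 = k →
      Building s₀ S l' s₁ →
      WP w body (fun τ s' => τ ≤ T ∧ s'.reg 34 = k ∧ Building s₀ S (l' ++ [f k]) s') s₁) :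
    WP w (forDown 34 N body) (fun τ s' => τ ≤ s₀.reg N * (T + 2) + 2 ∧
      Building s₀ S (l ++ ((List.range (s₀.reg N)).map f).reverse) s') s := by
  have hN' : s.reg N = s₀.reg N := h.reg N hN
  have key := WP.forDown (w := w) (r := 34) (N := N) (body := body) (s := s)
    (fun k s' => Building s₀ S (l ++ ((List.range' k (s.reg N - k)).map f).reverse) s')
    (fun _ => 0) T
    (fun k s' h => ⟨(h.reg 0 (by norm_num)).trans h0, (h.reg 1 (by norm_num)).trans h1⟩)
    (fun k s' x h => h.setReg le_rfl x) (by rwa [hN']) (fun k hk s₁ hs₁ hI => ?_) (by simpa using h)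
  · refine key.mono fun τ s' h => ⟨?_, ?_⟩
    · simpa [hN'] using h.2
    · simpa [hN', List.range_eq_range'] using h.1
  · refine (hbody k (by rwa [← hN']) _ s₁ ?_ hs₁ hI).mono fun τ s' h => ⟨h.2.1, ?_, by omega⟩
    · simp; omega
    · rw [map_range'_reverse f hk, ← List.append_assoc]
      exact h.2.2

/-- Write the SubsetSum instance for the blocks with offsets `R[15]` and `R[16]`. -/
def buildInstance : Prog :=
  .seq (.op .add 33 8 0) <| .seq (push 17) <| .seq (push 18) <| .seq (push 1) <| .seq (push 19) <|
  .seq (forDown 34 5 <| .seq (.op .add 35 15 34) <| .seq (.op .add 35 35 10) <|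
    .seq (.load 35 35) <| .seq (.op .add 36 21 34) <| .seq (.op .mul 36 36 20) <|
    .seq (.op .add 35 36 35) (push 35)) <|
  .seq (forDown 34 5 <| .seq (.op .add 35 16 34) <| .seq (.op .add 35 35 11) <|
    .seq (.load 35 35) <| .seq (.op .add 36 22 34) <| .seq (.op .mul 36 36 20) <|
    .seq (.op .add 35 36 35) (push 35)) <|
  .seq (forDown 34 24 <| .seq (.op .add 35 15 16) <| .seq (.op .add 35 35 34) <|
    .seq (.op .add 35 35 12) <| .seq (.load 35 35) <| .seq (.op .sub 35 9 35) <|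
    .seq (.op .sub 36 23 34) <| .seq (.op .mul 36 36 20) <|
    .seq (.op .add 35 36 35) (push 35)) <|
  .seq (.op .div 34 9 25) (.loop 34 (.seq (push 34) (.op .div 34 34 25)))

theorem wp_powers {w n v m L S : ℕ} {s₀ s : State} {l : List ℕ} (hc : Consts n v m L S s₀)
    (hS : 0 < S) (hL : 2 ^ L < 2 ^ w) (hw : (l.length + L) * S + s₀.reg 8 < 2 ^ w)
    (h : Building s₀ S l s) :
    WP w (.seq (.op .div 34 9 25) (.loop 34 (.seq (push 34) (.op .div 34 34 25))))
      (fun τ s' => τ ≤ L * 4 + 2 ∧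
        Building s₀ S (l ++ ((List.range L).map (2 ^ ·)).reverse) s') s := by
  have e9 : s.reg 9 = 2 ^ L := (h.reg 9 (by norm_num)).trans hc.r9
  have e25 : s.reg 25 = 2 := (h.reg 25 (by norm_num)).trans hc.r25
  have hhalf (k : ℕ) : 2 ^ (k + 1) / 2 = 2 ^ k := by rw [pow_succ]; simp
  simp only [wp_seq (P := .op _ _ _ _), wp_op, Op.eval, e9, e25]
  refine ⟨by omega, ?_⟩
  have key := WP.loop (w := w) (r := 34) (P := .seq (push 34) (.op .div 34 34 25))
    -- With `k` iterations left the register holds the next power `2 ^ (k - 1)`. Written as `2 ^ k /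
    -- 2` it becomes `0` at `k = 0`, which ends the loop.
    (fun k s' => k ≤ L ∧ s'.reg 34 = 2 ^ k / 2 ∧
      Building s₀ S (l ++ ((List.range' k (L - k)).map (2 ^ ·)).reverse) s') (fun _ => 0) 3
    (fun s' h => by simpa using h.2.1) ?_ L (s := s.setReg 34 (2 ^ L / 2))
    ⟨le_rfl, by simp, by simpa using h.setReg le_rfl _⟩
  · refine key.mono fun τ s' h => ⟨by have := h.2; omega, ?_⟩
    simpa [List.range_eq_range'] using h.1.2.2
  · rintro k s₁ ⟨hk, hr, hB⟩
    rw [hhalf] at hr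
    refine ⟨by rw [hr]; positivity, ?_⟩
    have hkL : 2 ^ k < 2 ^ L := Nat.pow_lt_pow_right (by norm_num) hk
    refine (wp_push hB hS hc.r7 ?_).seq fun τ₁ s₂ ⟨hτ, hB₂, hr₂⟩ => ?_
    · refine lt_of_le_of_lt ?_ hw
      refine Nat.add_le_add_right (Nat.mul_le_mul_right _ ?_) _
      simp only [List.length_append, List.length_reverse, List.length_map, List.length_range']
      omega
    · have e25 : s₂.reg 25 = 2 := (hB₂.reg 25 (by norm_num)).trans hc.r25
      rw [wp_op, Op.eval, hr₂ 34 (by norm_num), hr, e25]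
      refine ⟨by omega, ⟨by omega, by simp, ?_⟩, by omega⟩
      rw [map_range'_reverse _ hk, ← List.append_assoc, ← hr]
      exact hB₂.setReg le_rfl _

theorem wp_buildInstance {w n v m L S i₀ j₀ : ℕ} {A B E : ℕ → ℕ} {s : State}
    (hc : Consts n v m L S s) (hw : WordBounds w v m L S) (ha : Arrays v S A B E s)
    (h8 : s.reg 8 < S) (h15 : s.reg 15 = i₀) (h16 : s.reg 16 = j₀) (hi : i₀ + m ≤ v)
    (hj : j₀ + m ≤ v) (hA : ∀ i, A i ≤ 2 ^ L) (hB : ∀ i, B i ≤ 2 ^ L)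
    (hE : ∀ k < 2 * v, E k ≤ 2 ^ L) :
    WP w buildInstance (fun τ s' => τ ≤ 50 * m + 4 * L + 20 ∧
      (∀ r < 32, s'.reg r = s.reg r) ∧
      (∀ x, (∀ a, x ≠ a * S + s.reg 8) → s'.mem x = s.mem x) ∧
      ∀ a, s'.mem (a * S + s.reg 8) = ((4 * m + L) :: MinConvInstance.target m L :: 1 ::
        (1096 * m) :: MinConvInstance.items m L (fun i => A (i₀ + i)) (fun j => B (j₀ + j))
          (fun l => E (i₀ + j₀ + l))).getD a 0) s := by
  have hm := hw.m_pos
  have hv := hw.v_le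
  have hS : 0 < S := by omega
  have hSw := hw.S_le
  have hD : 0 < 2 ^ L := by positivity
  have hitem {x y : ℕ} (hx : x ≤ 114 * m) (hy : y ≤ 2 ^ L) :
      x < 2 ^ w ∧ x * (8 * 2 ^ L) < 2 ^ w ∧ x * (8 * 2 ^ L) + y < 2 ^ w := by
    have h1 : x * (8 * 2 ^ L) ≤ 114 * m * (8 * 2 ^ L) := Nat.mul_le_mul_right _ hx
    have h2 : 1 * 2 ^ L ≤ m * 2 ^ L := Nat.mul_le_mul_right _ hm
    have h3 := hw.items_le
    have h4 : x ≤ x * (8 * 2 ^ L) := Nat.le_mul_of_pos_right _ (by positivity)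
    have h5 : x * (8 * 2 ^ L) + y < 2 ^ w := by nlinarith
    omega
  have hlen {l : ℕ} (hl : l ≤ 4 * m + L + 4) : l * S + s.reg 8 < 2 ^ w := by
    have h1 : (l + 1) * S ≤ (4 * m + L + 6) * S := Nat.mul_le_mul_right _ (by omega)
    rw [add_mul] at h1
    omega
  have hSlt : S + S ≤ 2 ^ w := by
    have h1 : 2 * S ≤ (4 * m + L + 6) * S := Nat.mul_le_mul_right _ (by omega)
    omega
  have hDw := hitem (x := 0) (y := 2 ^ L) (by omega) le_rfl
  have hstart : Building s S [] (s.setReg 33 (s.reg 8)) := by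
    refine ⟨fun r hr => by simp [show r ≠ 33 by omega], fun x _ => rfl, fun a => ?_, by simp⟩
    simpa using ha.fresh _ le_rfl h8 a
  simp only [buildInstance, wp_seq (P := .op .add 33 8 0), wp_op, Op.eval, hc.r0, Nat.add_zero]
  refine ⟨by omega, ?_⟩
  refine (wp_push hstart hS hc.r7 (hlen (by simp))).seq fun τ₁ s₁ ⟨hτ₁, hB₁, hr₁⟩ => ?_
  refine (wp_push hB₁ hS hc.r7 (hlen (by simp))).seq fun τ₂ s₂ ⟨hτ₂, hB₂, hr₂⟩ => ?_
  refine (wp_push hB₂ hS hc.r7 (hlen (by simp))).seq fun τ₃ s₃ ⟨hτ₃, hB₃, hr₃⟩ => ?_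
  refine (wp_push hB₃ hS hc.r7 (hlen (by simp))).seq fun τ₄ s₄ ⟨hτ₄, hB₄, hr₄⟩ => ?_
  rw [hB₃.reg 19 (by norm_num), hB₂.reg 1 (by norm_num), hB₁.reg 18 (by norm_num),
    hstart.reg 17 (by norm_num), hc.r1, hc.r17, hc.r18, hc.r19] at hB₄
  -- The arrays lie below `8 * v`, while all cells of a call region are at or above `s.reg 8 ≥ 8 *
  -- v`; building leaves the arrays intact.
  have get {l : List ℕ} {s' : State} (h : Building s S l s') {x : ℕ} (hx : x < 8 * v) :
      s'.mem x = s.mem x := h.mem_of_lt (hx.trans_le ha.off_ge)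
  refine (wp_forDown_push (T := 8) (MinConvInstance.itemA m L fun i => A (i₀ + i)) hc.r0 hc.r1
    (by norm_num) (by rw [hc.r5]; omega) hB₄ ?_).seq fun τ₅ s₅ ⟨hτ₅, hB₅⟩ => ?_
  · rw [hc.r5]
    intro k hk l s' hl h34 h
    simp only [List.nil_append, List.cons_append, List.length_cons, List.length_nil] at hl
    have hc' := hc.congr (s' := s') fun r hr _ _ => h.reg r hr
    have e15 := (h.reg 15 (by norm_num)).trans h15
    have hmem : s'.mem (i₀ + k + 4 * v) = A (i₀ + k) := by
      rw [get h (by omega), add_comm, ha.memA _ (by omega)]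
    have hit := hitem (x := 64 * m + k) (y := A (i₀ + k)) (by omega) (hA _)
    simp [-wp_seq, wp_seq (P := .op _ _ _ _), wp_seq (P := .load _ _), Op.eval, h34, e15, hc'.r10,
      hmem, hc'.r21, hc'.r20]
    refine ⟨by omega, by omega, by omega, by omega, by omega, by omega, ?_⟩
    refine (wp_push ((((((h.setReg ?_ _).setReg ?_ _).setReg ?_ _).setReg ?_ _).setReg ?_ _).setReg
      ?_ _) hS hc.r7 (hlen (by omega))).mono fun τ s'' ⟨h1, h2, h3⟩ => ⟨by omega, ?_, ?_⟩
    iterate 6 norm_num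
    · rw [h3 34 (by norm_num)]; simpa using h34
    · simpa [MinConvInstance.itemA] using h2
  refine (wp_forDown_push (T := 8) (MinConvInstance.itemB m L fun j => B (j₀ + j)) hc.r0 hc.r1
    (by norm_num) (by rw [hc.r5]; omega) hB₅ ?_).seq fun τ₆ s₆ ⟨hτ₆, hB₆⟩ => ?_
  · rw [hc.r5]
    intro k hk l s' hl h34 h
    simp only [List.nil_append, List.cons_append, List.length_cons,
      List.length_reverse, List.length_map, List.length_range] at hl
    have hc' := hc.congr (s' := s') fun r hr _ _ => h.reg r hr
    have e16 := (h.reg 16 (by norm_num)).trans h16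
    have hmem : s'.mem (j₀ + k + 5 * v) = B (j₀ + k) := by
      rw [get h (by omega), add_comm, ha.memB _ (by omega)]
    have hit := hitem (x := 96 * m + k) (y := B (j₀ + k)) (by omega) (hB _)
    simp [-wp_seq, wp_seq (P := .op _ _ _ _), wp_seq (P := .load _ _), Op.eval, h34, e16, hc'.r11,
      hmem, hc'.r22, hc'.r20]
    refine ⟨by omega, by omega, by omega, by omega, by omega, by omega, ?_⟩
    refine (wp_push ((((((h.setReg ?_ _).setReg ?_ _).setReg ?_ _).setReg ?_ _).setReg ?_ _).setReg
      ?_ _) hS hc.r7 (hlen (by omega))).mono fun τ s'' ⟨h1, h2, h3⟩ => ⟨by omega, ?_, ?_⟩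
    iterate 6 norm_num
    · rw [h3 34 (by norm_num)]; simpa using h34
    · simpa [MinConvInstance.itemB] using h2
  refine (wp_forDown_push (T := 10) (MinConvInstance.itemC m L fun l => E (i₀ + j₀ + l)) hc.r0 hc.r1
    (by norm_num) (by rw [hc.r24]; omega) hB₆ ?_).seq fun τ₇ s₇ ⟨hτ₇, hB₇⟩ => ?_
  · rw [hc.r5, hc.r24]
    intro k hk l s' hl h34 h
    simp only [List.nil_append, List.cons_append, List.length_cons,
      List.length_append, List.length_reverse, List.length_map, List.length_range] at hl
    have hc' := hc.congr (s' := s') fun r hr _ _ => h.reg r hr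
    have e15 := (h.reg 15 (by norm_num)).trans h15
    have e16 := (h.reg 16 (by norm_num)).trans h16
    have hmem : s'.mem (i₀ + j₀ + k + 6 * v) = E (i₀ + j₀ + k) := by
      rw [get h (by omega), add_comm, ha.memE _ (by omega)]
    have hEk := hE (i₀ + j₀ + k) (by omega)
    have hit := hitem (x := 114 * m - k) (y := 2 ^ L - E (i₀ + j₀ + k)) (by omega) (by omega)
    simp [-wp_seq, wp_seq (P := .op _ _ _ _), wp_seq (P := .load _ _), Op.eval, h34, e15, e16,
      hc'.r12, hmem, hc'.r9, hc'.r23, hc'.r20]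
    refine ⟨by omega, by omega, by omega, by omega, by omega, by omega, by omega, by omega, ?_⟩
    refine (wp_push (((((((((h.setReg ?_ _).setReg ?_ _).setReg ?_ _).setReg ?_ _).setReg ?_
      _).setReg ?_ _).setReg ?_ _).setReg ?_ _)) hS hc.r7 (hlen (by omega))).mono
      fun τ s'' ⟨h1, h2, h3⟩ => ⟨by omega, ?_, ?_⟩
    iterate 8 norm_num
    · rw [h3 34 (by norm_num)]; simpa using h34
    · simpa [MinConvInstance.itemC] using h2
  refine (wp_powers hc hS (by omega) (hlen ?_) hB₇).mono fun τ₈ s₈ ⟨hτ₈, hB₈⟩ => ⟨?_, hB₈.reg,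
    hB₈.frame, ?_⟩
  · simp [hc.r5, hc.r24]; omega
  · rw [hc.r5] at hτ₅ hτ₆
    rw [hc.r24] at hτ₇
    omega
  · simpa [MinConvInstance.items, hc.r5, hc.r24] using hB₈.holds


/-! ### Thresholds and their repair by brute force -/

theorem Arrays.congr {v S : ℕ} {A B E : ℕ → ℕ} {s s' : State} (h : Arrays v S A B E s)
    (h8 : s'.reg 8 = s.reg 8) (hm : s'.mem = s.mem) : Arrays v S A B E s' := by
  constructor
  · rw [hm]; exact h.memA
  · rw [hm]; exact h.memB
  · rw [hm]; exact h.memE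
  · rw [h8]; exact h.off_ge
  · rw [h8, hm]; exact h.fresh

theorem Arrays.setReg {v S : ℕ} {A B E : ℕ → ℕ} {s : State} (h : Arrays v S A B E s)
    {r : ℕ} (hr : r ≠ 8) (x : ℕ) : Arrays v S A B E (s.setReg r x) :=
  h.congr (by simp [hr.symm]) rfl

/-- The arrays survive a call, which uses up one memory region. -/
theorem Arrays.next {v S : ℕ} {A B E : ℕ → ℕ} {s s' : State} (h : Arrays v S A B E s)
    (h8 : s'.reg 8 = s.reg 8 + 1) (hlt : s.reg 8 < S)
    (hm : ∀ x, (∀ a, x ≠ a * S + s.reg 8) → s'.mem x = s.mem x) : Arrays v S A B E s' := by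
  have h0 := h.off_ge
  have hm' {x : ℕ} (hx : x < 8 * v) : s'.mem x = s.mem x := hm x fun a => by omega
  constructor
  · intro i hi; rw [hm' (by omega), h.memA i hi]
  · intro i hi; rw [hm' (by omega), h.memB i hi]
  · intro k hk; rw [hm' (by omega), h.memE k hk]
  · omega
  · intro j hj hjS a
    rw [hm _ fun a' e => ?_, h.fresh j (by omega) hjS]
    have e' := congrArg (· % S) e
    simp only [Nat.mul_add_mod_self_right, Nat.mod_eq_of_lt hjS, Nat.mod_eq_of_lt hlt] at e'
    omega

theorem Arrays.store {v S : ℕ} {A B E : ℕ → ℕ} {s : State} (h : Arrays v S A B E s) {k x : ℕ}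
    (hk : k < 2 * v) :
    Arrays v S A B (Function.update E k x) (s.setMem (6 * v + k) x) := by
  have h0 := h.off_ge
  constructor
  · intro i hi; simpa [show 4 * v + i ≠ 6 * v + k by omega] using h.memA i hi
  · intro i hi; simpa [show 5 * v + i ≠ 6 * v + k by omega] using h.memB i hi
  · intro k' hk'; simp [Function.update_apply, h.memE k' hk']
  · exact h0
  · intro j hj hjS a
    simpa [show a * S + j ≠ 6 * v + k by simp at hj; omega] using h.fresh j hj hjS a

/-- The state of the thresholds within a round with step width `σ`: the threshold `E₀ k` has
been increased by `σ`, and this is revoked only if it was too much. -/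
def Marking (v σ : ℕ) (A B E₀ E : ℕ → ℕ) : Prop :=
  ∀ k < 2 * v, E k = E₀ k + σ ∨
    E k = E₀ k ∧ ∃ i < v, ∃ j < v, i + j = k ∧ A i + B j < E₀ k + σ

/-- The number of thresholds whose increase has not been revoked. -/
def unmarked (v : ℕ) (E₀ : ℕ → ℕ) (mem : ℕ → ℕ) : ℕ :=
  ((Finset.range (2 * v)).filter fun k => mem (6 * v + k) ≠ E₀ k).card

/-- `Marking` leaves two possible values per threshold, `E₀ k` and `E₀ k + σ`. A decrease is thus a
return to `E₀ k`, and as no threshold grows, the set of unrevoked indices shrinks strictly. -/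
theorem unmarked_lt {v σ S : ℕ} {A B E₀ E E' : ℕ → ℕ} {s s' : State} (hσ : 0 < σ)
    (ha : Arrays v S A B E s) (ha' : Arrays v S A B E' s') (hM : Marking v σ A B E₀ E)
    (hM' : Marking v σ A B E₀ E') (hle : ∀ k < 2 * v, E' k ≤ E k) {k : ℕ} (hk : k < 2 * v)
    (hlt : E' k < E k) : unmarked v E₀ s'.mem < unmarked v E₀ s.mem := by
  refine Finset.card_lt_card (Finset.ssubset_iff_of_subset ?_ |>.2 ⟨k, ?_, ?_⟩)
  · intro k hk
    simp only [Finset.mem_filter, Finset.mem_range] at hk ⊢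
    refine ⟨hk.1, ?_⟩
    have h := hk.2
    rw [ha'.memE k hk.1] at h
    rw [ha.memE k hk.1]
    have := hle k hk.1
    rcases hM k hk.1 with h1 | ⟨h1, -⟩ <;> rcases hM' k hk.1 with h2 | ⟨h2, -⟩ <;> omega
  · simp only [Finset.mem_filter, Finset.mem_range]
    refine ⟨hk, ?_⟩
    rw [ha.memE k hk]
    rcases hM k hk with h1 | ⟨h1, -⟩ <;> rcases hM' k hk with h2 | ⟨h2, -⟩ <;> omega
  · simp only [Finset.mem_filter, Finset.mem_range, not_and, not_not]
    intro _
    rw [ha'.memE k hk]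
    rcases hM k hk with h1 | ⟨h1, -⟩ <;> rcases hM' k hk with h2 | ⟨h2, -⟩ <;> omega

/-- Revoke the increase of the threshold violated by the pair with number `R[34]`. -/
def bruteForceStep : Prog :=
  .seq (.op .div 35 34 5) <| .seq (.op .add 35 15 35) <|
    .seq (.op .mod 36 34 5) <| .seq (.op .add 36 16 36) <|
    .seq (.op .add 37 10 35) <| .seq (.load 37 37) <|
    .seq (.op .add 38 11 36) <| .seq (.load 38 38) <| .seq (.op .add 37 37 38) <|
    .seq (.op .add 38 35 36) <| .seq (.op .add 38 12 38) <| .seq (.load 39 38) <|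
    .seq (.op .lt 37 37 39) <| .ite 37 (.seq (.op .sub 39 39 13) (.store 38 39)) .skip

/-- Revoke the increase of all thresholds violated by the blocks with offsets `R[15]`, `R[16]`. -/
def bruteForce : Prog := forDown 34 6 bruteForceStep

/-- The entries of both sequences are at most `2 ^ L`. -/
structure Bounded (L : ℕ) (A B : ℕ → ℕ) : Prop where
  left : ∀ i, A i ≤ 2 ^ L
  right : ∀ i, B i ≤ 2 ^ L

theorem WordBounds.facts {w v m L S : ℕ} (hw : WordBounds w v m L S) :
    S + S ≤ 2 ^ w ∧ 2 ^ 12 * 2 ^ L ≤ 2 ^ w := by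
  have h1 : 2 * S ≤ (4 * m + L + 6) * S := Nat.mul_le_mul_right _ (by omega)
  have h2 := hw.S_le
  have h3 : 2 ^ 12 * 1 * 2 ^ L ≤ 2 ^ 12 * m * 2 ^ L := by
    gcongr; exact hw.m_pos
  have h4 := hw.items_le
  omega

theorem wp_bruteForceStep {w n v m L S i₀ j₀ y : ℕ} {A B E : ℕ → ℕ} {s : State}
    (hc : Consts n v m L S s) (hw : WordBounds w v m L S) (ha : Arrays v S A B E s)
    (h34 : s.reg 34 = y) (h15 : s.reg 15 = i₀) (h16 : s.reg 16 = j₀)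
    (hdiv : y / m < m) (hmod : y % m < m) (hi : i₀ + m ≤ v)
    (hj : j₀ + m ≤ v) (hb : Bounded L A B)
    (hE : E (i₀ + y / m + (j₀ + y % m)) ≤ 2 ^ L) :
    WP w bruteForceStep (fun τ s' => τ ≤ 16 ∧ s'.reg 34 = s.reg 34 ∧
      (∀ r < 32, s'.reg r = s.reg r) ∧
      s'.mem = if A (i₀ + y / m) + B (j₀ + y % m) < E (i₀ + y / m + (j₀ + y % m)) then
        (s.setMem (6 * v + (i₀ + y / m + (j₀ + y % m)))
          (E (i₀ + y / m + (j₀ + y % m)) - s.reg 13)).mem else s.mem) s := by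
  have hv := hw.v_le
  obtain ⟨hSw, hLw⟩ := hw.facts
  have hD : 0 < 2 ^ L := by positivity
  have hA := hb.left (i₀ + y / m)
  have hB := hb.right (j₀ + y % m)
  have hmA := ha.memA (i₀ + y / m) (by omega)
  have hmB := ha.memB (j₀ + y % m) (by omega)
  have hmE := ha.memE (i₀ + y / m + (j₀ + y % m)) (by omega)
  simp [bruteForceStep, Op.eval, h34, hc.r5, hc.r10, hc.r11, hc.r12, h15, h16, hmA, hmB, hmE]
  refine ⟨by omega, by omega, by omega, by omega, by omega, by omega, by omega, by omega, by omega,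
    by omega, by omega, by omega, by split <;> omega, fun hlt => ⟨by omega, fun r hr => ?_, ?_⟩,
    fun hlt => ⟨fun r hr => ?_, ?_⟩⟩
  · simp (disch := omega) only [if_neg]
  · rw [if_pos hlt, if_pos hlt]; rfl
  · simp (disch := omega) only [if_neg]
  · intro h; omega

/-- Since `E₀` is a lower bound (`hlow`), a violated threshold must still be raised. Subtracting `σ`
restores `E₀`, and the violating pair is the witness that `Marking` asks for. Later revocations only
lower thresholds, so pairs already checked stay satisfied. -/
theorem wp_bruteForce {w n v m L S σ i₀ j₀ : ℕ} {A B E₀ E : ℕ → ℕ} {s : State}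
    (hc : Consts n v m L S s) (hw : WordBounds w v m L S) (ha : Arrays v S A B E s)
    (hg : m ^ 2 < 2 ^ w)
    (h13 : s.reg 13 = σ) (h15 : s.reg 15 = i₀) (h16 : s.reg 16 = j₀) (hi : i₀ + m ≤ v)
    (hj : j₀ + m ≤ v) (hb : Bounded L A B) (hσ : ∀ k < 2 * v, E₀ k + σ ≤ 2 ^ L)
    (hM : Marking v σ A B E₀ E) (hlow : ∀ i < v, ∀ j < v, E₀ (i + j) ≤ A i + B j) :
    WP w bruteForce (fun τ s' => τ ≤ m ^ 2 * 18 + 2 ∧ (∀ r < 32, s'.reg r = s.reg r) ∧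
      ∃ E', Arrays v S A B E' s' ∧ Marking v σ A B E₀ E' ∧ (∀ k < 2 * v, E' k ≤ E k) ∧
        ∀ i < m, ∀ j < m, E' (i₀ + i + (j₀ + j)) ≤ A (i₀ + i) + B (j₀ + j)) s := by
  have hm := hw.m_pos
  have hv := hw.v_le
  obtain ⟨hSw, hLw⟩ := hw.facts
  have hD : 0 < 2 ^ L := by positivity
  have key := WP.forDown (w := w) (r := 34) (N := 6) (s := s) (body := bruteForceStep)
    (fun y s' => (∀ r < 32, s'.reg r = s.reg r) ∧
      ∃ E', Arrays v S A B E' s' ∧ Marking v σ A B E₀ E' ∧ (∀ k < 2 * v, E' k ≤ E k) ∧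
        ∀ y' < m ^ 2, y ≤ y' → E' (i₀ + y' / m + (j₀ + y' % m)) ≤
          A (i₀ + y' / m) + B (j₀ + y' % m)) (fun _ => 0) 16
    (fun k s' h => ⟨(h.1 0 (by norm_num)).trans hc.r0, (h.1 1 (by norm_num)).trans hc.r1⟩)
    (fun k s' x h => ⟨fun r hr => by simpa [show r ≠ 34 by omega] using h.1 r hr, ?_⟩)
    (by rwa [hc.r6]) ?_ ⟨fun _ _ => rfl, E, ha, hM, fun _ _ => le_rfl, ?_⟩
  · refine key.mono fun τ s' ⟨⟨hr, E', h1, h2, h3, h4⟩, hτ⟩ => ⟨?_, hr, E', h1, h2, h3, ?_⟩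
    · simpa [hc.r6] using hτ
    · intro i hi j hj
      -- The single loop counter enumerates the index pairs of the two blocks as `i * m + j`.
      have e1 : (i * m + j) / m = i := by
        rw [add_comm, Nat.add_mul_div_right _ _ hm, Nat.div_eq_of_lt hj, zero_add]
      have e2 : (i * m + j) % m = j := by
        rw [Nat.mul_add_mod_self_right, Nat.mod_eq_of_lt hj]
      have := h4 (i * m + j) (by nlinarith) (Nat.zero_le _)
      rwa [e1, e2] at this
  · obtain ⟨-, E', h1, h2⟩ := h
    exact ⟨E', h1.setReg (by norm_num) _, h2⟩
  · rw [hc.r6]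
    rintro y hy s₁ hs₁ ⟨hr, E', h1, h2, h3, h4⟩
    have hc₁ := hc.congr (s' := s₁) fun r hr' _ _ => hr r hr'
    have e13 := (hr 13 (by norm_num)).trans h13
    have e15 := (hr 15 (by norm_num)).trans h15
    have e16 := (hr 16 (by norm_num)).trans h16
    have hdiv : y / m < m := by rw [Nat.div_lt_iff_lt_mul hm]; nlinarith
    have hmod : y % m < m := Nat.mod_lt _ hm
    have hl := hlow (i₀ + y / m) (by omega) (j₀ + y % m) (by omega)
    have hσ' := hσ (i₀ + y / m + (j₀ + y % m)) (by omega)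
    have hM' := h2 (i₀ + y / m + (j₀ + y % m)) (by omega)
    refine (wp_bruteForceStep hc₁ hw h1 hs₁ e15 e16 hdiv hmod hi hj hb ?_).mono
      fun τ s₂ ⟨hτ, hr34, hr₂, hm₂⟩ => ⟨hr34.trans hs₁, ⟨fun r hr' => (hr₂ r hr').trans (hr r hr'),
        ?_⟩, by omega⟩
    · rcases hM' with h | h <;> omega
    by_cases hlt : A (i₀ + y / m) + B (j₀ + y % m) < E' (i₀ + y / m + (j₀ + y % m))
    · rw [if_pos hlt, e13] at hm₂
      have hE' : E' (i₀ + y / m + (j₀ + y % m)) = E₀ (i₀ + y / m + (j₀ + y % m)) + σ := by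
        rcases hM' with h | h <;> omega
      have hle : ∀ k, Function.update E' (i₀ + y / m + (j₀ + y % m))
          (E' (i₀ + y / m + (j₀ + y % m)) - σ) k ≤ E' k := by
        intro k
        rw [Function.update_apply]
        split
        · next e => rw [e]; omega
        · exact le_rfl
      refine ⟨Function.update E' (i₀ + y / m + (j₀ + y % m))
          (E' (i₀ + y / m + (j₀ + y % m)) - σ), ?_, ?_, ?_, ?_⟩
      · exact (h1.store (by omega)).congr (by simpa using hr₂ 8 (by norm_num)) hm₂
      · intro k hk
        rw [Function.update_apply]
        split
        · next e =>
          rw [e]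
          exact .inr ⟨by omega, _, by omega, _, by omega, rfl, by omega⟩
        · exact h2 k hk
      · exact fun k hk => (hle k).trans (h3 k hk)
      · intro y' hy' hyy'
        rcases hyy'.eq_or_lt with rfl | hyy'
        · rw [Function.update_self]; omega
        · exact (hle _).trans (h4 y' hy' hyy')
    · rw [if_neg hlt] at hm₂
      refine ⟨E', h1.congr (hr₂ 8 (by norm_num)) hm₂, h2, h3, fun y' hy' hyy' => ?_⟩
      rcases hyy'.eq_or_lt with rfl | hyy'
      · omega
      · exact h4 y' hy' hyy'
  · rw [hc.r6]; intro y' h h'; omega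


/-! ### One pair of blocks -/

/-- Compute the offsets of the pair of blocks with number `R[14]`. -/
def blockOffsets : Prog :=
  .seq (.op .div 15 14 6) <| .seq (.op .mul 15 15 5) <| .seq (.op .mod 16 14 6)
    (.op .mul 16 16 5)

/-- Treat the pair of blocks with number `R[14]`, with the decision procedure `Q`. -/
def processBlock (Q : Prog) : Prog :=
  .seq blockOffsets <| .seq buildInstance <| .seq Q <| .seq (.op .add 8 8 1) <|
  .ite 32 bruteForce .skip

/-- Assumptions on the decision procedure. -/
def DecidesBlocks (w T m L S : ℕ) (Q : Prog) : Prop :=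
  ∀ A B C : ℕ → ℕ, (∀ i, A i ≤ 2 ^ L) → (∀ i, B i ≤ 2 ^ L) →
    DecidesGap w T Q (MinConvInstance.items m L A B C) (MinConvInstance.target m L) (1096 * m) S

/-- The time bound is amortized: brute force costs at most `18 * m ^ 2 + 2` steps and is paid for by
the drop of `unmarked`. The bound without potential covers building the instance and the call. -/
theorem wp_processBlock {w n v m L S σ x T : ℕ} {Q : Prog} {A B E₀ E : ℕ → ℕ} {s : State}
    (hc : Consts n v m L S s) (hw : WordBounds w v m L S) (hQ : DecidesBlocks w T m L S Q)
    (hv : v = m ^ 3) (hg : m ^ 4 < 2 ^ w) (ha : Arrays v S A B E s) (h8 : s.reg 8 < S)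
    (h13 : s.reg 13 = σ) (h14 : s.reg 14 = x) (hx : x < m ^ 4) (hb : Bounded L A B)
    (hσ : ∀ k < 2 * v, E₀ k + σ ≤ 2 ^ L) (hσ0 : 0 < σ)
    (hM : Marking v σ A B E₀ E) (hlow : ∀ i < v, ∀ j < v, E₀ (i + j) ≤ A i + B j) :
    WP w (processBlock Q) (fun τ s' =>
      τ + unmarked v E₀ s'.mem * (18 * m ^ 2 + 2) ≤
        (T + 50 * m + 4 * L + 30) + unmarked v E₀ s.mem * (18 * m ^ 2 + 2) ∧
      (∀ r < 32, r ≠ 8 → r ≠ 15 → r ≠ 16 → s'.reg r = s.reg r) ∧ s'.reg 8 = s.reg 8 + 1 ∧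
      ∃ E', Arrays v S A B E' s' ∧ Marking v σ A B E₀ E' ∧ (∀ k < 2 * v, E' k ≤ E k) ∧
        ∀ i < m, ∀ j < m, E' (x / m ^ 2 * m + i + (x % m ^ 2 * m + j)) ≤
          A (x / m ^ 2 * m + i) + B (x % m ^ 2 * m + j)) s := by
  have hm := hw.m_pos
  have hv8 := hw.v_le
  obtain ⟨hSw, hLw⟩ := hw.facts
  have hdiv : x / m ^ 2 < m ^ 2 := by
    rw [Nat.div_lt_iff_lt_mul (by positivity)]; convert hx using 1; ring
  have hmod : x % m ^ 2 < m ^ 2 := Nat.mod_lt _ (by positivity)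
  have hblock {y : ℕ} (hy : y < m ^ 2) : y * m + m ≤ v := by
    have : (y + 1) * m ≤ m ^ 2 * m := Nat.mul_le_mul_right _ hy
    rw [hv]; ring_nf at this ⊢; exact this
  have hi := hblock hdiv
  have hj := hblock hmod
  have hm2 : m ^ 2 < 2 ^ w := (Nat.pow_le_pow_right hm (by norm_num)).trans_lt hg
  set i₀ := x / m ^ 2 * m with hi₀
  set j₀ := x % m ^ 2 * m with hj₀
  have hE : ∀ k < 2 * v, E k ≤ 2 ^ L := fun k hk => by
    have := hσ k hk
    rcases hM k hk with h | h <;> omega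
  have hoff : WP w blockOffsets (fun τ s' => τ = 4 ∧ s'.reg 15 = i₀ ∧ s'.reg 16 = j₀ ∧
      (∀ r, r ≠ 15 → r ≠ 16 → s'.reg r = s.reg r) ∧ s'.mem = s.mem) s := by
    simp [blockOffsets, Op.eval, h14, hc.r6, hc.r5]
    refine ⟨by omega, by omega, by omega, by omega, rfl, rfl, fun r hr hr' => ?_⟩
    simp [hr, hr']
  refine hoff.seq fun τ₁ s₁ ⟨hτ₁, h15, h16, hr₁, hm₁⟩ => ?_
  have hc₁ := hc.congr (s' := s₁) fun r _ _ h => hr₁ r (by omega) (by omega)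
  have e8 := hr₁ 8 (by norm_num) (by norm_num)
  have ha₁ := ha.congr e8 hm₁
  refine (wp_buildInstance hc₁ hw ha₁ (by rwa [e8]) h15 h16 hi hj hb.left hb.right hE).seq
    fun τ₂ s₂ ⟨hτ₂, hr₂, hm₂, hl₂⟩ => ?_
  have hc₂ := hc₁.congr (s' := s₂) fun r hr _ _ => hr₂ r hr
  have e8₂ := hr₂ 8 (by norm_num)
  set X := MinConvInstance.items m L (fun i => A (i₀ + i)) (fun j => B (j₀ + j))
    (fun l => E (i₀ + j₀ + l)) with hX
  set t := MinConvInstance.target m L with ht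
  have hyes {i j : ℕ} (hi' : i < m) (hj' : j < m)
      (h : A (i₀ + i) + B (j₀ + j) < E (i₀ + j₀ + (i + j))) : subsetSumOpt X.toFinset t = t :=
    MinConvInstance.opt_eq_target (A := fun i => A (i₀ + i)) (B := fun j => B (j₀ + j))
      (C := fun l => E (i₀ + j₀ + l)) (fun _ => hb.left _) (fun _ => hb.right _) hi' hj'
      (hE _ (by omega)) h
  have hno (h : ∀ i < m, ∀ j < m, E (i₀ + j₀ + (i + j)) ≤ A (i₀ + i) + B (j₀ + j)) :=
    MinConvInstance.opt_lt_gap (L := L) (A := fun i => A (i₀ + i)) (B := fun j => B (j₀ + j))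
      (C := fun l => E (i₀ + j₀ + l)) hm (fun _ => hb.left _) (fun _ => hb.right _) h
  have ht0 : 0 < t := by
    have : 0 < 274 * m * (8 * 2 ^ L) := by positivity
    rw [ht, MinConvInstance.target]; omega
  have hlen : X.length = 4 * m + L := MinConvInstance.length_items _ _ _ _ _
  -- The gap promise always holds, since a violating pair attains the target and its absence leaves
  -- the gap.
  have hpromise : subsetSumOpt X.toFinset t = t ∨
      (subsetSumOpt X.toFinset t : ℝ) < (1 - 1 / ((1096 * m : ℕ) : ℝ)) * (t : ℝ) := by
    by_cases h : ∀ i < m, ∀ j < m, E (i₀ + j₀ + (i + j)) ≤ A (i₀ + i) + B (j₀ + j)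
    · exact .inr (hno h)
    · push Not at h
      obtain ⟨i, hi', j, hj', h⟩ := h
      exact .inl (hyes hi' hj' h)
  have hnot (h : ∀ i < m, ∀ j < m, E (i₀ + j₀ + (i + j)) ≤ A (i₀ + i) + B (j₀ + j)) :
      subsetSumOpt X.toFinset t ≠ t := by
    intro e
    have h1 := hno h
    rw [← hX, ← ht, e] at h1
    have h2 : (0 : ℝ) < t := by exact_mod_cast ht0
    have h3 : (0 : ℝ) ≤ 1 / ((1096 * m : ℕ) : ℝ) := by positivity
    nlinarith
  refine WP.seq (hQ _ _ _ (fun _ => hb.left _) (fun _ => hb.right _) hpromise s₂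
    (by rwa [e8₂, e8]) hc₂.r0 hc₂.r1 hc₂.r7 hc₂.r18 hc₂.r19
    (by rw [e8₂]; simpa only [← hX, hlen] using hl₂)) fun τ₃ s₃ ⟨hτ₃, hr₃, hm₃, h32⟩ => ?_
  have hr₃' : ∀ r < 32, r ≠ 15 → r ≠ 16 → s₃.reg r = s.reg r := fun r hr h h' => by
    rw [hr₃ r hr, hr₂ r hr, hr₁ r h h']
  have e8₃ : s₃.reg 8 = s.reg 8 := hr₃' 8 (by norm_num) (by norm_num) (by norm_num)
  have e1₃ : s₃.reg 1 = 1 := (hr₃' 1 (by norm_num) (by norm_num) (by norm_num)).trans hc.r1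
  rw [wp_seq, wp_op, Op.eval, e8₃, e1₃, wp_ite]
  refine ⟨by omega, ?_⟩
  set s₄ := s₃.setReg 8 (s.reg 8 + 1) with hs₄
  have hr₄ : ∀ r < 32, r ≠ 8 → r ≠ 15 → r ≠ 16 → s₄.reg r = s.reg r := fun r hr h h' h'' => by
    simpa [hs₄, h] using hr₃' r hr h' h''
  have e8₄ : s₄.reg 8 = s.reg 8 + 1 := by simp [hs₄]
  have e32₄ : s₄.reg 32 = s₃.reg 32 := by simp [hs₄]
  have e15₄ : s₄.reg 15 = i₀ := by
    simp [hs₄, hr₃ 15 (by norm_num), hr₂ 15 (by norm_num), h15]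
  have e16₄ : s₄.reg 16 = j₀ := by
    simp [hs₄, hr₃ 16 (by norm_num), hr₂ 16 (by norm_num), h16]
  have hc₄ := hc.congr (s' := s₄) fun r hr h h' => hr₄ r hr h (by omega) (by omega)
  have hm₄ : ∀ y, (∀ a, y ≠ a * S + s.reg 8) → s₄.mem y = s.mem y := fun y hy => by
    rw [hs₄, State.setReg_mem, hm₃ y (by rwa [e8₂, e8]), hm₂ y (by rwa [e8]), hm₁]
  have ha₄ := ha.next e8₄ h8 hm₄
  have hun : unmarked v E₀ s₄.mem = unmarked v E₀ s.mem := by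
    unfold unmarked
    refine congrArg Finset.card (Finset.filter_congr fun k hk => ?_)
    rw [ha₄.memE k (Finset.mem_range.1 hk), ha.memE k (Finset.mem_range.1 hk)]
  rw [e32₄, h32]
  constructor
  · intro hopt
    refine (wp_bruteForce hc₄ hw ha₄ hm2 ((hr₄ 13 (by norm_num) (by norm_num) (by norm_num)
      (by norm_num)).trans h13) e15₄ e16₄ hi hj hb hσ hM hlow).mono ?_
    rintro τ₅ s₅ ⟨hτ₅, hr₅, E', h1, h2, h3, h4⟩
    -- If no raise were revoked, the repaired inequalities would already have held before,
    -- contradicting the positive answer.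
    have hlt : unmarked v E₀ s₅.mem < unmarked v E₀ s₄.mem := by
      by_contra hcon
      refine hnot (fun i hi' j hj' => ?_) hopt
      have h5 := h4 i hi' j hj'
      rw [show i₀ + i + (j₀ + j) = i₀ + j₀ + (i + j) by ring] at h5
      by_contra h6
      exact hcon (unmarked_lt hσ0 ha₄ h1 hM h2 h3 (k := i₀ + j₀ + (i + j)) (by omega) (by omega))
    refine ⟨?_, fun r hr h h' h'' => (hr₅ r hr).trans (hr₄ r hr h h' h''),
      (hr₅ 8 (by norm_num)).trans e8₄, E', h1, h2, h3, h4⟩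
    rw [← hun]
    have : (unmarked v E₀ s₅.mem + 1) * (18 * m ^ 2 + 2) ≤
        unmarked v E₀ s₄.mem * (18 * m ^ 2 + 2) := Nat.mul_le_mul_right _ hlt
    rw [add_mul] at this
    omega
  · intro hopt
    rw [wp_skip]
    refine ⟨?_, hr₄, e8₄, E, ha₄, hM, fun _ _ => le_rfl, fun i hi' j hj' => ?_⟩
    · rw [hun]; omega
    · by_contra hcon
      refine h32.2 (hyes hi' hj' ?_) hopt
      rw [show i₀ + i + (j₀ + j) = i₀ + j₀ + (i + j) by ring] at hcon
      omega


/-! ### The binary search -/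

/-- Increase all thresholds by the step width. -/
def raise : Prog :=
  forDown 34 27 <| .seq (.op .add 35 12 34) <| .seq (.load 36 35) <| .seq (.op .add 36 36 13)
    (.store 35 36)

theorem wp_raise {w n v m L S σ : ℕ} {A B E : ℕ → ℕ} {s : State}
    (hc : Consts n v m L S s) (hw : WordBounds w v m L S) (ha : Arrays v S A B E s)
    (h13 : s.reg 13 = σ) (hσ : ∀ k < 2 * v, E k + σ ≤ 2 ^ L) :
    WP w raise (fun τ s' => τ ≤ 12 * v + 2 ∧ (∀ r < 32, s'.reg r = s.reg r) ∧
      Arrays v S A B (fun k => E k + σ) s') s := by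
  have hv := hw.v_le
  obtain ⟨hSw, hLw⟩ := hw.facts
  have hm := hw.m_pos
  have hD : 0 < 2 ^ L := by positivity
  have key := WP.forDown (w := w) (r := 34) (N := 27) (s := s)
    (body := .seq (.op .add 35 12 34) <| .seq (.load 36 35) <| .seq (.op .add 36 36 13)
      (.store 35 36))
    (fun y s' => (∀ r < 32, s'.reg r = s.reg r) ∧
      Arrays v S A B (fun k => if y ≤ k then E k + σ else E k) s') (fun _ => 0) 4
    (fun k s' h => ⟨(h.1 0 (by norm_num)).trans hc.r0, (h.1 1 (by norm_num)).trans hc.r1⟩)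
    (fun k s' x h => ⟨fun r hr => by simpa [show r ≠ 34 by omega] using h.1 r hr,
      h.2.setReg (by norm_num) _⟩)
    (by rw [hc.r27]; omega) ?_ ⟨fun _ _ => rfl, ?_⟩
  · refine key.mono fun τ s' ⟨⟨hr, h1⟩, hτ⟩ => ⟨?_, hr, by simpa using h1⟩
    rw [hc.r27] at hτ
    omega
  · rw [hc.r27]
    rintro y hy s₁ hs₁ ⟨hr, h1⟩
    have hc₁ := hc.congr (s' := s₁) fun r hr' _ _ => hr r hr'
    have e13 := (hr 13 (by norm_num)).trans h13
    have hmE := h1.memE y hy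
    rw [if_neg (by omega)] at hmE
    have hy' := hσ y hy
    simp [Op.eval, hs₁, hc₁.r12, e13, hmE]
    refine ⟨by omega, by omega, by omega, fun r hr' => ?_, ?_⟩
    · simp (disch := omega) only [if_neg]
      exact hr r hr'
    · have h2 := (h1.store (x := E y + σ) hy).congr (s' :=
        (((s₁.setReg 35 (6 * v + y)).setReg 36 (E y)).setReg 36 (E y + σ)).setMem (6 * v + y)
          (E y + σ)) (by simp) rfl
      convert h2 using 1
      ext k
      rw [Function.update_apply]
      rcases lt_trichotomy k y with h | rfl | h
      · simp [h.ne, show ¬ y ≤ k by omega, show ¬ y + 1 ≤ k by omega]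
      · simp
      · simp [h.ne', show y ≤ k by omega, show y + 1 ≤ k by omega]
  · rw [hc.r27]
    constructor
    · exact ha.memA
    · exact ha.memB
    · intro k hk; rw [if_neg (by omega)]; exact ha.memE k hk
    · exact ha.off_ge
    · exact ha.fresh

/-- Halve the uncertainty about all the minima. -/
def round (Q : Prog) : Prog := .seq raise (forDown 14 26 (processBlock Q))

/-- The thresholds are lower bounds on the minima that are tight up to less than `d`. -/
structure Approximates (v d : ℕ) (A B E : ℕ → ℕ) : Prop where
  lower : ∀ i < v, ∀ j < v, E (i + j) ≤ A i + B j
  upper : ∀ k < 2 * v - 1, ∃ i < v, ∃ j < v, i + j = k ∧ A i + B j < E k + d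

theorem unmarked_le (v : ℕ) (E₀ mem : ℕ → ℕ) : unmarked v E₀ mem ≤ 2 * v := by
  refine (Finset.card_filter_le _ _).trans ?_
  simp

/-- A threshold that keeps its raise retains the old witness, now with slack `σ` instead of `2 * σ`;
a revoked one has a witness within `σ` by `Marking`. The potential starts at no more than `2 * v *
(18 * m ^ 2 + 2)`, which gives the term `36 * (v * m ^ 2)` and `4 * v` of the term `16 * v`. -/
theorem wp_round {w n v m L S σ T : ℕ} {Q : Prog} {A B E : ℕ → ℕ} {s : State}
    (hc : Consts n v m L S s) (hw : WordBounds w v m L S) (hQ : DecidesBlocks w T m L S Q)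
    (hv : v = m ^ 3) (hg : m ^ 4 < 2 ^ w) (ha : Arrays v S A B E s) (h8 : s.reg 8 + m ^ 4 ≤ S)
    (h13 : s.reg 13 = σ) (hb : Bounded L A B)
    (hσ : ∀ k < 2 * v, E k + 2 * σ ≤ 2 ^ L) (hσ0 : 0 < σ) (hE : Approximates v (2 * σ) A B E) :
    WP w (round Q) (fun τ s' => τ ≤ m ^ 4 * (T + 50 * m + 4 * L + 32) + 36 * (v * m ^ 2) +
        16 * v + 4 ∧
      (∀ r < 32, r ≠ 8 → ¬ (14 ≤ r ∧ r ≤ 16) → s'.reg r = s.reg r) ∧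
      s'.reg 8 = s.reg 8 + m ^ 4 ∧ ∃ E', Arrays v S A B E' s' ∧
        (∀ k < 2 * v, E' k + σ ≤ 2 ^ L) ∧ Approximates v σ A B E') s := by
  have hm := hw.m_pos
  refine (wp_raise hc hw ha h13 fun k hk => by have := hσ k hk; omega).seq
    fun τ₁ s₁ ⟨hτ₁, hr₁, ha₁⟩ => ?_
  have hc₁ := hc.congr (s' := s₁) fun r hr _ _ => hr₁ r hr
  have e8 := hr₁ 8 (by norm_num)
  have key := WP.forDown (w := w) (r := 14) (N := 26) (s := s₁) (body := processBlock Q)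
    (fun x s' => (∀ r < 32, r ≠ 8 → ¬ (14 ≤ r ∧ r ≤ 16) → s'.reg r = s.reg r) ∧ x ≤ m ^ 4 ∧
      s'.reg 8 + x = s.reg 8 + m ^ 4 ∧
      ∃ E', Arrays v S A B E' s' ∧ Marking v σ A B E E' ∧
        ∀ x' < m ^ 4, x ≤ x' → ∀ i < m, ∀ j < m,
          E' (x' / m ^ 2 * m + i + (x' % m ^ 2 * m + j)) ≤
          A (x' / m ^ 2 * m + i) + B (x' % m ^ 2 * m + j))
    (fun mem => unmarked v E mem * (18 * m ^ 2 + 2)) (T + 50 * m + 4 * L + 30)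
    (fun k s' h => ⟨(h.1 0 (by norm_num) (by norm_num) (by norm_num)).trans hc.r0,
      (h.1 1 (by norm_num) (by norm_num) (by norm_num)).trans hc.r1⟩)
    (fun k s' x h => ⟨fun r hr h' h'' => by
      simpa [show r ≠ 14 by omega] using h.1 r hr h' h'', h.2.1, by simpa using h.2.2.1, ?_⟩)
    (by rwa [hc₁.r26]) ?_ ⟨fun r hr _ _ => hr₁ r hr, by rw [hc₁.r26], by rw [e8, hc₁.r26], _, ha₁,
      fun k hk => .inl rfl, ?_⟩
  · refine key.mono fun τ₂ s₂ ⟨⟨hr, _, e8₂, E', h1, h2, h3⟩, hτ⟩ => ⟨?_, hr, by omega, E', h1,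
      fun k hk => ?_, ⟨fun i hi j hj => ?_, fun k hk => ?_⟩⟩
    · rw [hc₁.r26] at hτ
      have hle := Nat.mul_le_mul_right (18 * m ^ 2 + 2) (unmarked_le v E s₁.mem)
      ring_nf at hτ hle ⊢
      omega
    · have := hσ k hk
      rcases h2 k hk with h | h <;> omega
    · have hi' : i / m < m ^ 2 := by
        rw [Nat.div_lt_iff_lt_mul hm]; rw [hv] at hi; convert hi using 1; ring
      have hj' : j / m < m ^ 2 := by
        rw [Nat.div_lt_iff_lt_mul hm]; rw [hv] at hj; convert hj using 1; ring
      -- This is the number of the block pair that contains `(i, j)`.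
      have hx : i / m * m ^ 2 + j / m < m ^ 4 := by
        have : (i / m + 1) * m ^ 2 ≤ m ^ 2 * m ^ 2 := Nat.mul_le_mul_right _ hi'
        rw [show m ^ 4 = m ^ 2 * m ^ 2 by ring]
        rw [add_mul] at this
        omega
      have e1 : (i / m * m ^ 2 + j / m) / m ^ 2 = i / m := by
        rw [add_comm, Nat.add_mul_div_right _ _ (by positivity), Nat.div_eq_of_lt hj', zero_add]
      have e2 : (i / m * m ^ 2 + j / m) % m ^ 2 = j / m := by
        rw [Nat.mul_add_mod_self_right, Nat.mod_eq_of_lt hj']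
      have := h3 _ hx (Nat.zero_le _) (i % m) (Nat.mod_lt _ hm) (j % m) (Nat.mod_lt _ hm)
      rwa [e1, e2, Nat.div_add_mod', Nat.div_add_mod'] at this
    · obtain ⟨i, hi, j, hj, e, hlt⟩ := hE.upper k hk
      rcases h2 k (by omega) with h | ⟨h, i', hi', j', hj', e', hlt'⟩
      · exact ⟨i, hi, j, hj, e, by omega⟩
      · exact ⟨i', hi', j', hj', e', by omega⟩
  · obtain ⟨-, -, -, E', h1, h2⟩ := h
    exact ⟨E', h1.setReg (by norm_num) _, h2⟩
  · rw [hc₁.r26]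
    rintro x hx s₂ hs₂ ⟨hr, hxm, e8₂, E', h1, h2, h3⟩
    have hc₂ := hc.congr (s' := s₂) fun r hr' h h' => hr r hr' h (by omega)
    refine (wp_processBlock hc₂ hw hQ hv hg h1 (by omega)
      ((hr 13 (by norm_num) (by norm_num) (by norm_num)).trans h13) hs₂ hx hb
      (fun k hk => by have := hσ k hk; omega) hσ0 h2 hE.lower).mono ?_
    rintro τ s₃ ⟨hτ, hr₃, e8₃, E'', h1', h2', hle, h3'⟩
    refine ⟨(hr₃ 14 (by norm_num) (by norm_num) (by norm_num) (by norm_num)).trans hs₂,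
      ⟨fun r hr' h h' => (hr₃ r hr' h (by omega) (by omega)).trans (hr r hr' h h'), by omega,
        by omega, E'', h1', h2', fun x' hx' hxx' i hi j hj => ?_⟩, hτ⟩
    rcases hxx'.eq_or_lt with rfl | hxx'
    · exact h3' i hi j hj
    -- Block pairs treated earlier stay satisfied because thresholds only decrease.
    · refine (hle _ ?_).trans (h3 x' hx' hxx' i hi j hj)
      have hdiv : x' / m ^ 2 < m ^ 2 := by
        rw [Nat.div_lt_iff_lt_mul (by positivity)]; convert hx' using 1; ring
      have hmod : x' % m ^ 2 < m ^ 2 := Nat.mod_lt _ (by positivity)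
      have hblock {y : ℕ} (hy : y < m ^ 2) : y * m + m ≤ v := by
        have : (y + 1) * m ≤ m ^ 2 * m := Nat.mul_le_mul_right _ hy
        rw [hv]; ring_nf at this ⊢; exact this
      have := hblock hdiv
      have := hblock hmod
      omega
  · rw [hc₁.r26]; intro x' hx' h; omega

/-- Starting with the step width `2 ^ (L - 1)`, determine all minima. -/
def rounds (Q : Prog) : Prog := .loop 13 (.seq (round Q) (.op .div 13 13 25))

theorem wp_rounds {w n v m L S T : ℕ} {Q : Prog} {A B E : ℕ → ℕ} {s : State}
    (hc : Consts n v m L S s) (hw : WordBounds w v m L S) (hQ : DecidesBlocks w T m L S Q)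
    (hv : v = m ^ 3) (hg : m ^ 4 < 2 ^ w) (ha : Arrays v S A B E s)
    (h8 : s.reg 8 + 2 ^ L * m ^ 4 ≤ S)
    (h13 : s.reg 13 = 2 ^ L / 2) (hb : Bounded L A B)
    (hσ : ∀ k < 2 * v, E k + 2 ^ L ≤ 2 ^ L) (hE : Approximates v (2 ^ L) A B E) :
    WP w (rounds Q) (fun τ s' => τ ≤ L * (m ^ 4 * (T + 50 * m + 4 * L + 32) +
        36 * (v * m ^ 2) + 16 * v + 6) + 1 ∧ Consts n v m L S s' ∧ ∃ E', Arrays v S A B E' s' ∧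
        Approximates v 1 A B E') s := by
  have hhalf (k : ℕ) : 2 ^ (k + 1) / 2 = 2 ^ k := by rw [pow_succ]; simp
  obtain ⟨hSw, hLw⟩ := hw.facts
  have key := WP.loop (w := w) (r := 13) (P := .seq (round Q) (.op .div 13 13 25)) (s := s)
    (fun k s' => k ≤ L ∧ s'.reg 13 = 2 ^ k / 2 ∧ Consts n v m L S s' ∧
      -- The reserve of fresh regions halves along with the uncertainty `2 ^ k`, whereas a round
      -- uses up only `m ^ 4` of them. The summand `m ^ 4` on the right pays for the last region
      -- block that `2 ^ 0` still demands.
      s'.reg 8 + 2 ^ k * m ^ 4 ≤ S + m ^ 4 ∧ ∃ E', Arrays v S A B E' s' ∧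
      (∀ k' < 2 * v, E' k' + 2 ^ k ≤ 2 ^ L) ∧ Approximates v (2 ^ k) A B E') (fun _ => 0)
    (m ^ 4 * (T + 50 * m + 4 * L + 32) + 36 * (v * m ^ 2) + 16 * v + 5)
    (fun s' h => by simpa using h.2.1) ?_ L ⟨le_rfl, h13, hc, by omega, E, ha, hσ, hE⟩
  · refine key.mono fun τ s' ⟨⟨_, _, h1, _, E', h2, _, h3⟩, hτ⟩ => ⟨?_, h1, E', h2, by simpa using h3⟩
    omega
  · rintro k s₁ ⟨hk, h13, hc₁, h8, E', h1, h2, h3⟩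
    rw [hhalf] at h13
    have hp : 0 < 2 ^ k := by positivity
    have hkL : 2 ^ k < 2 ^ L := Nat.pow_lt_pow_right (by norm_num) hk
    refine ⟨by omega, ?_⟩
    rw [pow_succ] at h8 h2 h3
    have hS : m ^ 4 ≤ 2 ^ k * m ^ 4 := Nat.le_mul_of_pos_left _ hp
    have e : 2 ^ k * 2 * m ^ 4 = 2 ^ k * m ^ 4 + 2 ^ k * m ^ 4 := by ring
    refine (wp_round hc₁ hw hQ hv hg h1 (by omega) h13 hb (fun k' hk' => by
      have := h2 k' hk'; omega) hp (by rwa [mul_comm 2])).seq ?_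
    rintro τ₁ s₂ ⟨hτ₁, hr₂, h8₂, E'', ha₂, hσ₂, hE₂⟩
    have hc₂ := hc₁.congr (s' := s₂) fun r hr h h' => hr₂ r hr h (by omega)
    rw [wp_op, Op.eval, hr₂ 13 (by norm_num) (by norm_num) (by norm_num), h13, hc₂.r25]
    refine ⟨by omega, ⟨by omega, by simp, hc₂.congr fun r _ _ h => ?_, ?_, E'',
      ha₂.setReg (by norm_num) _, hσ₂, hE₂⟩, by omega⟩
    · simp [show r ≠ 13 by omega]
    · simp; omega


/-! ### Initialization of sizes and constants -/

/-- Compute `v = 8 ^ k > R[2]` in register `3`, and `k` in register `31`. -/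
def findSize : Prog :=
  .seq (.const 3 1) <| .seq (.const 28 8) <| .seq (.op .lt 29 2 3) <| .seq (.op .eq 29 29 0) <|
  .loop 29 <| .seq (.op .add 31 31 1) <| .seq (.op .mul 3 3 28) <| .seq (.op .lt 29 2 3)
    (.op .eq 29 29 0)

/-- The hypotheses `hlow` and `hup` pin `k` down as the least exponent with `n < 8 ^ k`: the former
keeps the loop running, the latter stops it. -/
theorem wp_findSize {w n k : ℕ} {s : State} (h0 : s.reg 0 = 0) (h1 : s.reg 1 = 1)
    (h2 : s.reg 2 = n) (h31 : s.reg 31 = 0) (hlow : ∀ j < k, 8 ^ j ≤ n) (hup : n < 8 ^ k)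
    (hw : 8 * 8 ^ k < 2 ^ w) :
    WP w findSize (fun τ s' => τ ≤ 5 * k + 5 ∧ s'.reg 3 = 8 ^ k ∧ s'.reg 28 = 8 ∧ s'.reg 31 = k ∧
      (∀ r, r ≠ 3 → r ≠ 28 → r ≠ 29 → r ≠ 31 → s'.reg r = s.reg r) ∧ s'.mem = s.mem) s := by
  have hpos : 0 < 8 ^ k := by positivity
  have hite : ∀ b : Prop, ∀ [Decidable b], (if b then 1 else 0) < 2 ^ w := fun b _ => by
    split <;> omega
  simp only [findSize, wp_seq (P := .op _ _ _ _), wp_seq (P := .const _ _), wp_op, wp_const,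
    Op.eval, State.setReg_reg, reduceIte, Nat.reduceEqDiff, h0, h2]
  refine ⟨by omega, by omega, hite _, hite _, ?_⟩
  set s₀ := (((s.setReg 3 1).setReg 28 8).setReg 29 (if n < 1 then 1 else 0)).setReg 29
    (if (if n < 1 then 1 else 0) = 0 then 1 else 0) with hs₀
  have key := WP.loop (w := w) (r := 29) (s := s₀) (P := .seq (.op .add 31 31 1) <|
      .seq (.op .mul 3 3 28) <| .seq (.op .lt 29 2 3) (.op .eq 29 29 0))
    (fun j s' => j ≤ k ∧ s'.reg 31 = k - j ∧ s'.reg 3 = 8 ^ (k - j) ∧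
      s'.reg 29 = (if n < 8 ^ (k - j) then 0 else 1) ∧ s'.reg 28 = 8 ∧
      (∀ r, r ≠ 3 → r ≠ 28 → r ≠ 29 → r ≠ 31 → s'.reg r = s.reg r) ∧ s'.mem = s.mem)
    (fun _ => 0) 4 (fun s' h => by simp [h.2.2.2.1, hup]) ?_ k ?_
  · refine key.mono fun τ s' ⟨h, hτ⟩ => ⟨by omega, by simpa using h.2.2.1, h.2.2.2.2.1,
      by simpa using h.2.1, h.2.2.2.2.2⟩
  · rintro j s₁ ⟨hj, h31', h3, h29, h28, hr, hm⟩
    have e : 8 ^ (k - (j + 1)) * 8 = 8 ^ (k - j) := by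
      rw [← pow_succ]; congr 1; omega
    have hle : 8 ^ (k - j) ≤ 8 ^ k := Nat.pow_le_pow_right (by norm_num) (by omega)
    have hk : k < 8 ^ k := Nat.lt_pow_self (by norm_num)
    rw [if_neg (by have := hlow (k - (j + 1)) (by omega); omega)] at h29
    refine ⟨by omega, ?_⟩
    simp [Op.eval, h31', h3, h28, hr 1, h1, hr 2, h2, hr 0, h0, e]
    refine ⟨by omega, by omega, hite _, hite _, by omega, by omega, ?_,
      fun r h3 h28 h29 h31 => ?_, hm⟩
    · split <;> split <;> omega
    · simp [h3, h29, h31, hr r h3 h28 h29 h31]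
  · refine ⟨le_rfl, by simp [hs₀, h31], by simp [hs₀], ?_, by simp [hs₀],
      fun r h3 h28 h29 h31 => by simp [hs₀, h3, h28, h29], rfl⟩
    simp only [hs₀, State.setReg_reg, reduceIte, Nat.sub_self, pow_zero]
    split <;> split <;> omega

/-- Compute the constants that only depend on the sizes. -/
def sizeConstants : Prog :=
  .seq (.const 25 2) <| .seq (.op .shl 5 1 31) <| .seq (.op .mul 6 5 5) <|
  .seq (.op .mul 26 6 6) <| .seq (.op .add 27 3 3) <| .seq (.op .add 10 27 27) <|
  .seq (.op .add 11 10 3) <| .seq (.op .add 12 11 3) <| .seq (.op .add 24 5 5) <|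
  .seq (.op .mul 8 28 3) <|
  .seq (.const 30 64) <| .seq (.op .mul 21 30 5) <| .seq (.const 30 96) <|
  .seq (.op .mul 22 30 5) <| .seq (.const 30 114) <| .seq (.op .mul 23 30 5) <|
  .seq (.const 30 1096) (.op .mul 19 30 5)

theorem wp_sizeConstants {w k : ℕ} {s : State} (h1 : s.reg 1 = 1) (h3 : s.reg 3 = 8 ^ k)
    (h28 : s.reg 28 = 8) (h31 : s.reg 31 = k) (hw : 2 ^ 12 * (2 ^ k) ^ 4 < 2 ^ w) :
    WP w sizeConstants (fun τ s' => τ = 18 ∧ (∀ r, (r ≤ 4 ∨ 28 = r ∨ 31 ≤ r) →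
      s'.reg r = s.reg r) ∧
      s'.mem = s.mem ∧ s'.reg 5 = 2 ^ k ∧ s'.reg 6 = (2 ^ k) ^ 2 ∧ s'.reg 26 = (2 ^ k) ^ 4 ∧
      s'.reg 27 = 2 * 8 ^ k ∧ s'.reg 10 = 4 * 8 ^ k ∧ s'.reg 11 = 5 * 8 ^ k ∧
      s'.reg 12 = 6 * 8 ^ k ∧ s'.reg 24 = 2 * 2 ^ k ∧ s'.reg 8 = 8 * 8 ^ k ∧
      s'.reg 21 = 64 * 2 ^ k ∧ s'.reg 22 = 96 * 2 ^ k ∧ s'.reg 23 = 114 * 2 ^ k ∧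
      s'.reg 19 = 1096 * 2 ^ k ∧ s'.reg 25 = 2) s := by
  have e8 : 8 ^ k = (2 ^ k) ^ 3 := by rw [← pow_mul, mul_comm, pow_mul]; norm_num
  rw [e8] at h3 ⊢
  have hm : 0 < 2 ^ k := by positivity
  set m := 2 ^ k with hmdef
  have p2 : m ≤ m ^ 2 := Nat.le_self_pow (by norm_num) m
  have p3 : m ^ 2 ≤ m ^ 3 := Nat.pow_le_pow_right hm (by norm_num)
  have p4 : m ^ 3 ≤ m ^ 4 := Nat.pow_le_pow_right hm (by norm_num)
  have e2 : m * m = m ^ 2 := by ring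
  have e4 : m ^ 2 * m ^ 2 = m ^ 4 := by ring
  simp only [sizeConstants, wp_seq, wp_op, wp_const, Op.eval, State.setReg_reg, State.setReg_mem,
    reduceIte, Nat.reduceEqDiff, h1, h3, h28, h31, Nat.shiftLeft_eq, e2, e4, ← hmdef, one_mul, true_and, and_true]
  refine ⟨by omega, by omega, by omega, by omega, by omega, by omega, by omega, by omega, by omega,
    by omega, by omega, by omega, by omega, by omega, by omega, by omega, by omega, by omega,
    fun r hr => ?_, by omega, by omega, by omega, by omega, by omega⟩
  clear * - hr
  simp (disch := omega) only [if_neg]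

/-- Compute the remaining constants. -/
def valueConstants (c : ℕ) : Prog :=
  .seq (.const 30 3) <| .seq (.op .mul 17 30 31) <| .seq (.op .add 17 17 1) <|
  .seq (.const 30 c) <| .seq (.op .mul 17 17 30) <| .seq (.const 30 3) <|
  .seq (.op .add 17 17 30) <| .seq (.op .shl 9 1 17) <| .seq (.op .div 13 9 25) <|
  .seq (.op .div 4 13 25) <| .seq (.op .mul 20 28 9) <| .seq (.const 30 274) <|
  .seq (.op .mul 18 30 5) <| .seq (.op .mul 18 18 20) <| .seq (.op .sub 30 9 1) <|
  .seq (.op .add 18 18 30) <| .seq (.op .add 30 24 24) <| .seq (.op .add 17 30 17) <|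
  .seq (.op .mul 7 9 26) (.op .add 7 7 8)

theorem wp_valueConstants {w k c m L : ℕ} {s : State} (hL : L = (3 * k + 1) * c + 3)
    (h1 : s.reg 1 = 1) (h31 : s.reg 31 = k) (h25 : s.reg 25 = 2) (h28 : s.reg 28 = 8)
    (h5 : s.reg 5 = m) (h24 : s.reg 24 = 2 * m) (h26 : s.reg 26 = m ^ 4) (hm : 0 < m)
    (hkm : 3 * k + 1 < 2 ^ w) (h8 : s.reg 8 + 2 ^ L * m ^ 4 < 2 ^ w) (hcw : c < 2 ^ w)
    (hlen : 4 * m + L < 2 ^ w) (hw : 2 ^ 12 * m * 2 ^ L ≤ 2 ^ w) :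
    WP w (valueConstants c) (fun τ s' => τ = 20 ∧
      (∀ r, (r ≤ 3 ∨ r = 5 ∨ r = 6 ∨ r = 8 ∨ 10 ≤ r ∧ r ≤ 12 ∨ r = 19 ∨ 21 ≤ r ∧ r ≠ 30) →
        s'.reg r = s.reg r) ∧ s'.mem = s.mem ∧
      s'.reg 9 = 2 ^ L ∧ s'.reg 13 = 2 ^ L / 2 ∧ s'.reg 4 = 2 ^ L / 4 ∧ s'.reg 20 = 8 * 2 ^ L ∧
      s'.reg 18 = MinConvInstance.target m L ∧ s'.reg 17 = 4 * m + L ∧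
      s'.reg 7 = s.reg 8 + 2 ^ L * m ^ 4) s := by
  have hD : 0 < 2 ^ L := by positivity
  have h2 : 1 * 2 ^ L ≤ m * 2 ^ L := Nat.mul_le_mul_right _ hm
  have hLL : L < 2 ^ L := Nat.lt_two_pow_self
  have e1 : 274 * m * (8 * 2 ^ L) = 2192 * (m * 2 ^ L) := by ring
  have e2 : 2 ^ 12 * m * 2 ^ L = 4096 * (m * 2 ^ L) := by ring
  have h3 : m * 1 ≤ m * 2 ^ L := Nat.mul_le_mul_left _ hD
  simp only [valueConstants, wp_seq, wp_op, wp_const, Op.eval, State.setReg_reg,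
    State.setReg_mem, reduceIte, Nat.reduceEqDiff, h1, h31, h25, h28, h5, h24, h26,
    Nat.shiftLeft_eq, one_mul, true_and, ← hL,
    MinConvInstance.target]
  refine ⟨by omega, by omega, by omega, by omega, by omega, by omega, by omega, by omega, by omega,
    by omega, by omega, by omega, by omega, by omega, by omega, by omega, by omega, by omega,
    by omega, by omega, fun r hr => ?_, by omega, by omega, by omega⟩
  clear * - hr
  simp (disch := omega) only [if_neg]


/-! ### Padding the input and writing the output -/

/-- Copy the entries with number `R[34]` of both input sequences to their places; beyond the end,
the value in register `4` is used. -/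
def copyStep : Prog :=
  .seq (.op .lt 35 34 2) <|
  .seq (.ite 35 (.seq (.op .add 36 34 1) <| .seq (.load 37 36) <| .seq (.op .add 36 36 2)
    (.load 38 36)) (.seq (.op .add 37 4 0) (.op .add 38 4 0))) <|
  .seq (.op .add 36 10 34) <| .seq (.store 36 37) <| .seq (.op .add 36 11 34) (.store 36 38)

theorem wp_copyStep {w n v m L S i p : ℕ} {A B : ℕ → ℕ} {s : State}
    (hc : Consts n v m L S s) (hw : WordBounds w v m L S) (hb : Bounded L A B)
    (h34 : s.reg 34 = i) (hi : i < v) (hn : n < v) (h4 : s.reg 4 = p)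
    (hA : ∀ i < n, s.mem (i + 1) = A i) (hB : ∀ i < n, s.mem (i + 1 + n) = B i)
    (hA' : ∀ i, n ≤ i → A i = p) (hB' : ∀ i, n ≤ i → B i = p) :
    WP w copyStep (fun τ s' => τ ≤ 10 ∧ (∀ r < 35, s'.reg r = s.reg r) ∧
      s'.mem = ((s.setMem (4 * v + i) (A i)).setMem (5 * v + i) (B i)).mem) s := by
  have hv := hw.v_le
  obtain ⟨hSw, hLw⟩ := hw.facts
  have hD : 0 < 2 ^ L := by positivity
  have h1 := hb.left i
  have h2 := hb.right i
  simp only [copyStep, wp_seq, wp_op, wp_load, wp_store, wp_ite, Op.eval, State.setReg_reg,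
    State.setReg_mem, State.setMem_reg, reduceIte, Nat.reduceEqDiff, h34, hc.r0, hc.r1, hc.r2,
    hc.r10, hc.r11, h4]
  refine ⟨by split <;> omega, fun h => ?_, fun h => ?_⟩
  · have hin : i < n := by by_contra hcon; rw [if_neg hcon] at h; exact h rfl
    simp only [hA i hin, hB i hin]
    refine ⟨by omega, by omega, by omega, by omega, by omega, by omega, by omega, fun r hr => ?_,
      rfl⟩
    clear * - hr
    simp (disch := omega) only [if_neg]
  · have hin : n ≤ i := by by_contra hcon; rw [if_pos (by omega)] at h; omega
    have e1 := hA' i hin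
    have e2 := hB' i hin
    -- The program copies the padding value by adding register `0`, so it occurs in the goal as `p +
    -- 0`.
    rw [← Nat.add_zero p] at e1 e2
    simp only [← e1]
    refine ⟨by omega, by omega, by omega, by omega, by omega, fun r hr => ?_, ?_⟩
    · clear * - hr
      simp (disch := omega) only [if_neg]
    · rw [e1, e2]; rfl

/-- Fill the arrays `A` and `B`. -/
def copyInput : Prog := forDown 34 3 copyStep

/-- The input ends at cell `2 * n < 4 * v`, so copying never overwrites what is still to be read.
The zero thresholds and the empty call regions need no work, as these cells are zero from the start.
-/
theorem wp_copyInput {w n v m L S p : ℕ} {A B : ℕ → ℕ} {s : State}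
    (hc : Consts n v m L S s) (hw : WordBounds w v m L S) (hb : Bounded L A B)
    (hn : n < v) (h4 : s.reg 4 = p) (h8 : s.reg 8 = 8 * v)
    (hA : ∀ i < n, s.mem (i + 1) = A i) (hB : ∀ i < n, s.mem (i + 1 + n) = B i)
    (hA' : ∀ i, n ≤ i → A i = p) (hB' : ∀ i, n ≤ i → B i = p)
    (h0 : ∀ x, 2 * n < x → s.mem x = 0) :
    WP w copyInput (fun τ s' => τ ≤ 12 * v + 2 ∧ (∀ r < 32, s'.reg r = s.reg r) ∧
      Arrays v S A B (fun _ => 0) s') s := by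
  have hv := hw.v_le
  obtain ⟨hSw, hLw⟩ := hw.facts
  have key := WP.forDown (w := w) (r := 34) (N := 3) (s := s) (body := copyStep)
    (fun y s' => (∀ r < 34, s'.reg r = s.reg r) ∧
      (∀ x, (x < 4 * v ∨ 6 * v ≤ x) → s'.mem x = s.mem x) ∧
      (∀ i < v, y ≤ i → s'.mem (4 * v + i) = A i ∧ s'.mem (5 * v + i) = B i)) (fun _ => 0) 10
    (fun k s' h => ⟨(h.1 0 (by norm_num)).trans hc.r0, (h.1 1 (by norm_num)).trans hc.r1⟩)
    (fun k s' x h => ⟨fun r hr => by simpa [show r ≠ 34 by omega] using h.1 r hr, h.2⟩)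
    (by rw [hc.r3]; omega) ?_ ⟨fun _ _ => rfl, fun _ _ => rfl, fun i hi h => ?_⟩
  · refine key.mono fun τ s' ⟨⟨hr, h1, h2⟩, hτ⟩ => ⟨?_, fun r hr' => hr r (by omega), ?_⟩
    · rw [hc.r3] at hτ; omega
    · have e8 := (hr 8 (by norm_num)).trans h8
      refine ⟨fun i hi => (h2 i hi (Nat.zero_le _)).1, fun i hi => (h2 i hi (Nat.zero_le _)).2,
        fun k hk => ?_, e8.ge, fun j hj hjS a => ?_⟩
      · rw [h1 _ (by omega), h0 _ (by omega)]
      · rw [h1 _ (by omega), h0 _ (by omega)]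
  · rw [hc.r3]
    rintro y hy s₁ hs₁ ⟨hr, h1, h2⟩
    have hc₁ := hc.congr (s' := s₁) fun r hr' _ _ => hr r (by omega)
    refine (wp_copyStep hc₁ hw hb hs₁ hy hn ((hr 4 (by norm_num)).trans h4)
      (fun i hi => by rw [h1 _ (by omega), hA i hi]) (fun i hi => by rw [h1 _ (by omega), hB i hi])
      hA' hB').mono fun τ s₂ ⟨hτ, hr₂, hm₂⟩ => ⟨(hr₂ 34 (by norm_num)).trans hs₁,
        ⟨fun r hr' => (hr₂ r (by omega)).trans (hr r hr'), fun x hx => ?_, fun i hi hyi => ?_⟩,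
        by omega⟩
    · rw [hm₂, ← h1 x hx]
      simp [show x ≠ 4 * v + y by omega, show x ≠ 5 * v + y by omega]
    · rw [hm₂]
      rcases hyi.eq_or_lt with rfl | hyi
      · simp [show 4 * v ≠ 5 * v by omega]
      · simpa [show i ≠ y by omega, show 4 * v + i ≠ 5 * v + y by omega,
          show 5 * v + i ≠ 4 * v + y by omega] using h2 i hi hyi
  · rw [hc.r3] at h; omega

/-- Write the first `2 * n` thresholds to the beginning of the memory. -/
def output : Prog :=
  .seq (.op .add 31 2 2) <| forDown 34 31 <| .seq (.op .add 35 12 34) <| .seq (.load 36 35)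
    (.store 34 36)

/-- The results go to cells below `2 * n`, well clear of the thresholds at `6 * v` and above. Index
`2 * n - 1` is no output of MinConv; it is copied along, and `hE'` only ensures that this does not
overflow. -/
theorem wp_output {w n v m L S : ℕ} {A B E : ℕ → ℕ} {s : State}
    (hc : Consts n v m L S s) (hw : WordBounds w v m L S) (hn : n < v)
    (ha : Arrays v S A B E s) (hE : ∀ k < 2 * n - 1, E k < 2 ^ w) (hE' : E (2 * n - 1) < 2 ^ w) :
    WP w output (fun τ s' => τ ≤ 10 * v + 3 ∧ ∀ k < 2 * n, s'.mem k = E k) s := by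
  have hv := hw.v_le
  obtain ⟨hSw, hLw⟩ := hw.facts
  simp only [output, wp_seq (P := .op .add 31 2 2), wp_op, Op.eval, hc.r2]
  refine ⟨by omega, ?_⟩
  have key := WP.forDown (w := w) (r := 34) (N := 31) (s := s.setReg 31 (n + n))
    (body := .seq (.op .add 35 12 34) <| .seq (.load 36 35) (.store 34 36))
    (fun y s' => (∀ r < 31, s'.reg r = s.reg r) ∧
      (∀ x, 2 * n ≤ x → s'.mem x = s.mem x) ∧ (∀ k < 2 * n, y ≤ k → s'.mem k = E k))
    (fun _ => 0) 3
    (fun k s' h => ⟨(h.1 0 (by norm_num)).trans hc.r0, (h.1 1 (by norm_num)).trans hc.r1⟩)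
    (fun k s' x h => ⟨fun r hr => by simpa [show r ≠ 34 by omega] using h.1 r hr, h.2⟩)
    (by simp; omega) ?_ ⟨fun r hr => by simp [show r ≠ 31 by omega], fun _ _ => rfl,
      fun k hk h => by simp at h; omega⟩
  · refine key.mono fun τ s' ⟨⟨hr, h1, h2⟩, hτ⟩ => ⟨?_, fun k hk => h2 k hk (Nat.zero_le _)⟩
    simp only [State.setReg_reg, reduceIte] at hτ
    omega
  · simp only [State.setReg_reg, reduceIte]
    rintro y hy s₁ hs₁ ⟨hr, h1, h2⟩
    have hEy : E y < 2 ^ w := by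
      rcases Nat.lt_or_ge y (2 * n - 1) with h | h
      · exact hE y h
      · rwa [show y = 2 * n - 1 by omega]
    have hm : s₁.mem (6 * v + y) = E y := by rw [h1 _ (by omega), ha.memE y (by omega)]
    simp only [wp_seq, wp_op, wp_load, wp_store, Op.eval, State.setReg_reg, State.setReg_mem,
      State.setMem_reg, State.setMem_mem, reduceIte, Nat.reduceEqDiff, hs₁, hr 12 (by norm_num),
      hc.r12, hm, true_and]
    refine ⟨by omega, hEy, ⟨fun r hr' => ?_, fun x hx => ?_, fun k hk hyk => ?_⟩, by omega⟩
    · rw [if_neg (by omega), if_neg (by omega), hr r hr']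
    · rw [if_neg (by omega), h1 x hx]
    · split
      · next h => rw [h]
      · exact h2 k hk (by omega)

/-! ### The complete program -/

/-- The program for MinConv. -/
def minConvProg (c : ℕ) (Q : Prog) : Prog :=
  .seq (.const 1 1) <| .seq (.load 2 0) <| .seq findSize <| .seq sizeConstants <|
  .seq (valueConstants c) <| .seq copyInput <| .seq (rounds Q) output

/-- A pair involving padding sums to at least `2 * p`, more than any sum of two genuine entries.
With slack 1 over the integers, the pair from `Approximates` attains the threshold, so it must be
genuine. -/
theorem isMinConvOutput_of_approximates {n v p : ℕ} (hn : n < v) {A B : Fin n → ℕ}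
    {A' B' E out : ℕ → ℕ}
    (hA : ∀ i : Fin n, A' i = A i) (hB : ∀ i : Fin n, B' i = B i) (hA' : ∀ i, n ≤ i → A' i = 2 * p)
    (hB' : ∀ i, n ≤ i → B' i = 2 * p) (hAp : ∀ i, A i < p) (hBp : ∀ i, B i < p)
    (hE : Approximates v 1 A' B' E) (hout : ∀ k < 2 * n, out k = E k) :
    IsMinConvOutput A B out := by
  intro k hk
  rw [hout k (by omega)]
  have hlow (i j : Fin n) (h : (i : ℕ) + j = k) : E k ≤ A i + B j := by
    have := hE.lower i (by omega) j (by omega)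
    rwa [hA, hB, h] at this
  constructor
  · obtain ⟨i, hi, j, hj, e, hlt⟩ := hE.upper k (by omega)
    -- Some genuine pair with index sum `k`, which bounds the threshold below `2 * p`.
    have h1 := hlow ⟨min k (n - 1), by omega⟩ ⟨k - min k (n - 1), by omega⟩ (by simp)
    have h2 := hAp ⟨min k (n - 1), by omega⟩
    have h3 := hBp ⟨k - min k (n - 1), by omega⟩
    have hin : i < n := by
      by_contra hcon
      have := hA' i (by omega)
      have := hE.lower i hi j hj
      rw [e] at this
      omega
    have hjn : j < n := by
      by_contra hcon
      have := hB' j (by omega)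
      omega
    refine ⟨⟨i, hin⟩, ⟨j, hjn⟩, e, ?_⟩
    have h4 := hlow ⟨i, hin⟩ ⟨j, hjn⟩ e
    have h5 := hA ⟨i, hin⟩
    have h6 := hB ⟨j, hjn⟩
    simp only at h5 h6
    omega
  · rintro _ ⟨i, j, e, rfl⟩
    exact hlow i j e

theorem wp_minConvProg {w n k c v m L S T : ℕ} {Q : Prog} (hn : 1 ≤ n) {A B : Fin n → ℕ}
    (hlow : ∀ j < k, 8 ^ j ≤ n) (hup : n < 8 ^ k) (hm : m = 2 ^ k) (hv : v = m ^ 3)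
    (hL : L = (3 * k + 1) * c + 3) (hSeq : S = 8 * v + 2 ^ L * m ^ 4)
    (hA : ∀ i, A i < 2 ^ ((3 * k + 1) * c)) (hB : ∀ i, B i < 2 ^ ((3 * k + 1) * c))
    (hw : WordBounds w v m L S) (hw4 : 2 ^ 12 * m ^ 4 < 2 ^ w)
    (hQ : DecidesBlocks w T m L S Q) :
    WP w (minConvProg c Q) (fun τ s' => τ ≤ L * (m ^ 4 * (T + 50 * m + 4 * L + 32) +
        36 * (v * m ^ 2) + 16 * v + 6) + 30 * v + 60 ∧ IsMinConvOutput A B s'.mem)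
      (inputState (n :: (List.ofFn A ++ List.ofFn B))) := by
  have hv' : v = 8 ^ k := by rw [hv, hm, ← pow_mul, mul_comm, pow_mul]; norm_num
  have hm0 := hw.m_pos
  have hv8 := hw.v_le
  obtain ⟨hSw, hLw⟩ := hw.facts
  have hSl := hw.S_le
  have hkm : k < m := hm ▸ Nat.lt_two_pow_self
  have hm4 : m ≤ m ^ 4 := Nat.le_self_pow (by norm_num) m
  set p := 2 ^ ((3 * k + 1) * c) with hp
  -- The summand 3 in `L` serves the padding: the value `2 ^ L / 4` is `2 * p`, and sums of padded
  -- entries, at most `4 * p`, stay below `2 ^ L`. Zero thresholds thus have uncertainty `2 ^ L` at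
  -- the start.
  have hLp : 2 ^ L = 8 * p := by rw [hL, pow_add, ← hp]; ring
  have hp0 : 0 < p := by positivity
  have hcL : c ≤ (3 * k + 1) * c := Nat.le_mul_of_pos_left _ (by omega)
  have hLL : L < 2 ^ L := Nat.lt_two_pow_self
  have hlenS : 4 * m + L + 6 ≤ (4 * m + L + 6) * S := Nat.le_mul_of_pos_right _ (by omega)
  have hkv : k < 8 ^ k := Nat.lt_pow_self (by norm_num)
  set s₀ := inputState (n :: (List.ofFn A ++ List.ofFn B)) with hs₀
  have hmem0 : s₀.mem 0 = n := rfl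
  have hmemA (i : Fin n) : s₀.mem (i + 1) = A i := by
    simp [hs₀, inputState, List.getElem?_append]
  have hmemB (i : Fin n) : s₀.mem (i + 1 + n) = B i := by
    simp [hs₀, inputState, show (i : ℕ) + 1 + n = i + n + 1 by omega]
  have hmem' (x : ℕ) (hx : 2 * n < x) : s₀.mem x = 0 := by
    simp only [hs₀, inputState]
    rw [List.getD_eq_default]
    simp; omega
  simp only [minConvProg, wp_seq (P := .const _ _), wp_seq (P := .load _ _), wp_const, wp_load]
  rw [State.setReg_mem, State.setReg_reg, if_neg (by norm_num), show s₀.reg 0 = 0 from rfl, hmem0]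
  refine ⟨by omega, by omega, ?_⟩
  refine (wp_findSize (n := n) (k := k) (by simp [hs₀, inputState]) (by simp) (by simp)
    (by simp [hs₀, inputState]) hlow hup (by omega)).seq ?_
  rintro τ₁ s₁ ⟨hτ₁, h3, h28, h31, hr₁, hm₁⟩
  have e1 : s₁.reg 1 = 1 := by rw [hr₁ 1]; simp; all_goals norm_num
  refine (wp_sizeConstants (k := k) e1 h3 h28 h31 (hm ▸ hw4)).seq ?_
  rintro τ₂ s₂ ⟨hτ₂, hr₂, hm₂, h5, h6, h26, h27, h10, h11, h12, h24, h8, h21, h22, h23, h19, h25⟩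
  rw [← hm] at h5 h6 h26 h24 h21 h22 h23 h19
  rw [← hv'] at h3 h27 h10 h11 h12 h8
  refine (wp_valueConstants hL ((hr₂ 1 (by norm_num)).trans e1) ((hr₂ 31 (by norm_num)).trans h31)
    h25 ((hr₂ 28 (by norm_num)).trans h28) h5 h24 h26 hm0 (by omega)
    (by rw [h8, ← hSeq]; omega) (by omega) (by omega) hw.items_le).seq ?_
  rintro τ₃ s₃ ⟨hτ₃, hr₃, hm₃, h9, h13, h4, h20, h18, h17, h7⟩
  have hr₁₃ : ∀ r < 3, s₃.reg r = ((s₀.setReg 1 1).setReg 2 n).reg r := fun r hr => by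
    rw [hr₃ r (by omega), hr₂ r (by omega), hr₁ r (by omega) (by omega) (by omega) (by omega)]
  have hc : Consts n v m L S s₃ := by
    constructor
    · simp [hr₁₃, hs₀, inputState]
    · simp [hr₁₃]
    · simp [hr₁₃]
    · rw [hr₃ 3 (by norm_num), hr₂ 3 (by norm_num), h3]
    · rw [hr₃ 5 (by norm_num), h5]
    · rw [hr₃ 6 (by norm_num), h6]
    · rw [h7, h8, hSeq]
    · exact h9
    · rw [hr₃ 10 (by norm_num), h10]
    · rw [hr₃ 11 (by norm_num), h11]
    · rw [hr₃ 12 (by norm_num), h12]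
    · exact h17
    · exact h18
    · rw [hr₃ 19 (by norm_num), h19]
    · exact h20
    · rw [hr₃ 21 (by norm_num), h21]
    · rw [hr₃ 22 (by norm_num), h22]
    · rw [hr₃ 23 (by norm_num), h23]
    · rw [hr₃ 24 (by norm_num), h24]
    · rw [hr₃ 25 (by norm_num), h25]
    · rw [hr₃ 26 (by norm_num), h26]
    · rw [hr₃ 27 (by norm_num), h27]
  have hm₀ : s₃.mem = s₀.mem := by rw [hm₃, hm₂, hm₁]; rfl
  set A' : ℕ → ℕ := fun i => if h : i < n then A ⟨i, h⟩ else 2 * p with hA'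
  set B' : ℕ → ℕ := fun i => if h : i < n then B ⟨i, h⟩ else 2 * p with hB'
  have hA'p (i : ℕ) : A' i ≤ 2 * p := by
    simp only [hA']; split
    · exact (hA _).le.trans (by omega)
    · exact le_rfl
  have hB'p (i : ℕ) : B' i ≤ 2 * p := by
    simp only [hB']; split
    · exact (hB _).le.trans (by omega)
    · exact le_rfl
  have hb : Bounded L A' B' := ⟨fun i => (hA'p i).trans (by omega),
    fun i => (hB'p i).trans (by omega)⟩
  have hnA (i : ℕ) (h : n ≤ i) : A' i = 2 * p := by simp [hA', show ¬ i < n by omega]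
  have hnB (i : ℕ) (h : n ≤ i) : B' i = 2 * p := by simp [hB', show ¬ i < n by omega]
  have hAA (i : Fin n) : A' i = A i := by simp [hA']
  have hBB (i : Fin n) : B' i = B i := by simp [hB']
  have e8 : s₃.reg 8 = 8 * v := (hr₃ 8 (by norm_num)).trans h8
  refine (wp_copyInput hc hw hb (hv' ▸ hup) (p := 2 * p) (by rw [h4, hLp]; omega) e8
    (fun i hi => by rw [hm₀]; exact (hmemA ⟨i, hi⟩).trans (hAA ⟨i, hi⟩).symm)
    (fun i hi => by rw [hm₀]; exact (hmemB ⟨i, hi⟩).trans (hBB ⟨i, hi⟩).symm) hnA hnB (hm₀ ▸ hmem')).seq ?_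
  rintro τ₄ s₄ ⟨hτ₄, hr₄, ha⟩
  have hc₄ := hc.congr (s' := s₄) fun r hr _ _ => hr₄ r hr
  refine (wp_rounds hc₄ hw hQ hv (by omega) ha (by rw [hr₄ 8 (by norm_num), e8, hSeq])
    ((hr₄ 13 (by norm_num)).trans h13) hb (fun _ _ => by simp) ⟨fun _ _ _ _ => Nat.zero_le _,
      fun k hk => ⟨min k (v - 1), by omega, k - min k (v - 1), by omega, by omega, ?_⟩⟩).seq ?_
  · have := hA'p (min k (v - 1))
    have := hB'p (k - min k (v - 1))
    omega
  rintro τ₅ s₅ ⟨hτ₅, hc₅, E, ha₅, hE⟩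
  have hEw : ∀ k < 2 * v - 1, E k < 2 ^ w := fun k hk => by
    have h1 := hE.lower (min k (v - 1)) (by omega) (k - min k (v - 1)) (by omega)
    rw [show min k (v - 1) + (k - min k (v - 1)) = k by omega] at h1
    have := hA'p (min k (v - 1))
    have := hB'p (k - min k (v - 1))
    omega
  have hnv : n < v := hv' ▸ hup
  refine (wp_output hc₅ hw hnv ha₅ (fun k hk => hEw k (by omega)) (hEw _ (by omega))).mono ?_
  rintro τ₆ s₆ ⟨hτ₆, hout⟩
  refine ⟨by omega, isMinConvOutput_of_approximates hnv hAA hBB hnA hnB hA hB hE hout⟩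


/-! ### Word sizes and running time -/

theorem validGapInput_items {c k m L : ℕ} {A B C : ℕ → ℕ} (hm : m = 2 ^ k)
    (hL : L = (3 * k + 1) * c + 3) (hA : ∀ i, A i ≤ 2 ^ L) (hB : ∀ i, B i ≤ 2 ^ L) :
    ValidGapInput (3 * c + 4) (MinConvInstance.items m L A B C) (MinConvInstance.target m L)
      (1096 * m) := by
  have hm0 : 0 < m := hm ▸ by positivity
  have hlen : (MinConvInstance.items m L A B C).length = 4 * m + L :=
    MinConvInstance.length_items _ _ _ _ _
  have hsize : k + 11 ≤ (4 * m + L + 1096 * m).size := by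
    by_contra hcon
    have h1 : (4 * m + L + 1096 * m).size ≤ k + 10 := by omega
    rw [Nat.size_le, pow_add, ← hm] at h1
    omega
  -- The numbers have about `k + L` bits with `L` about `3 * k * c`, and the size parameter has at
  -- least `k + 11` bits; this dictates the exponent `3 * c + 4`.
  have hpow : 2 ^ 12 * m * 2 ^ L ≤ 2 ^ ((3 * c + 4) * (4 * m + L + 1096 * m).size) := by
    rw [hm, ← pow_add, ← pow_add, ← hm]
    refine Nat.pow_le_pow_right (by norm_num) ?_
    refine le_trans ?_ (Nat.mul_le_mul_left _ hsize)
    rw [hL]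
    ring_nf
    omega
  have hD : 0 < 2 ^ L := by positivity
  have e : 2 ^ 12 * m * 2 ^ L = 4096 * (m * 2 ^ L) := by ring
  have e1 : 274 * m * (8 * 2 ^ L) = 2192 * (m * 2 ^ L) := by ring
  have e2 : (114 * m + 1) * (8 * 2 ^ L) = 912 * (m * 2 ^ L) + 8 * 2 ^ L := by ring
  have h1 : 1 * 2 ^ L ≤ m * 2 ^ L := Nat.mul_le_mul_right _ hm0
  have h2 : m * 1 ≤ m * 2 ^ L := Nat.mul_le_mul_left _ hD
  refine ⟨MinConvInstance.nodup_items hA hB, fun x hx => ?_, ?_, ?_, by omega, ?_⟩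
  · have := MinConvInstance.items_pos_lt hA hB hx
    rw [hlen]
    omega
  · rw [MinConvInstance.target]; omega
  · rw [hlen, MinConvInstance.target]; omega
  · rw [hlen]; omega

/-- The word size that suffices for the MinConv program. -/
theorem wordBounds_of_size {κ c k m L S z w : ℕ} (hm : m = 2 ^ k)
    (hL : L = (3 * k + 1) * c + 3) (hS : S = 8 * m ^ 3 + 2 ^ L * m ^ 4) (hkz : k ≤ z) (hz : 1 ≤ z)
    (hw : w = ((κ + 1) * (4 * c + 16) + 2 * (4 * c + 3) + 40) * z) :
    WordBounds w (m ^ 3) m L S ∧ 2 ^ 12 * m ^ 4 < 2 ^ w ∧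
      2 ^ (κ * (4 * m + L + 1096 * m).size) * S ≤ 2 ^ w := by
  have hm0 : 0 < m := hm ▸ by positivity
  have hLz : L ≤ (4 * c + 3) * z := by
    rw [hL]
    have : k * c ≤ z * c := Nat.mul_le_mul_right _ hkz
    have : 1 * c ≤ z * c := Nat.mul_le_mul_right _ hz
    nlinarith
  have hLL : L < 2 ^ L := Nat.lt_two_pow_self
  have hsize : (4 * m + L + 1096 * m).size ≤ (4 * c + 16) * z := by
    refine le_trans (b := k + L + 12) ?_ ?_
    · rw [Nat.size_le, pow_add, pow_add, ← hm]
      nlinarith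
    · nlinarith
  have hw' : w = (κ + 1) * ((4 * c + 16) * z) + 2 * ((4 * c + 3) * z) + 40 * z := by rw [hw]; ring
  have hL3 : 3 ≤ L := by omega
  have h8 : 8 ≤ 2 ^ L := (Nat.pow_le_pow_right (by norm_num) hL3 : 2 ^ 3 ≤ 2 ^ L)
  have hm34 : m ^ 3 ≤ m ^ 4 := Nat.pow_le_pow_right hm0 (by norm_num)
  -- Although there is a region for each of up to `2 ^ L * m ^ 4` calls, addresses still have only
  -- `O(log n)` bits.
  have hSle : S ≤ 2 ^ (L + 4 * k + 1) := by
    have e : 2 ^ (L + 4 * k + 1) = 2 ^ L * m ^ 4 + 2 ^ L * m ^ 4 := by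
      rw [hm, ← pow_mul, mul_comm k 4]; ring
    rw [e, hS]
    exact Nat.add_le_add_right (Nat.mul_le_mul h8 hm34) _
  have hA : (4 * c + 16) * z ≤ (κ + 1) * ((4 * c + 16) * z) :=
    Nat.le_mul_of_pos_left _ (Nat.succ_pos κ)
  have hz4 : 16 * z ≤ (4 * c + 16) * z := Nat.mul_le_mul_right _ (by omega)
  refine ⟨⟨hm0, by rw [hS]; omega, ?_, ?_⟩, ?_, ?_⟩
  · refine (Nat.mul_le_mul (n₁ := 4 * m + L + 6) (n₂ := 2 ^ (k + L + 4)) ?_ hSle).trans ?_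
    · rw [pow_add, pow_add, ← hm]
      nlinarith
    · rw [← pow_add]
      exact Nat.pow_le_pow_right (by norm_num) (by omega)
  · rw [hm, ← pow_add, ← pow_add]
    exact Nat.pow_le_pow_right (by norm_num) (by omega)
  · rw [hm, ← pow_mul, ← pow_add]
    exact Nat.pow_lt_pow_right (by norm_num) (by omega)
  · refine (Nat.mul_le_mul_left _ hSle).trans ?_
    rw [← pow_add]
    refine Nat.pow_le_pow_right (by norm_num) ?_
    have : κ * (4 * m + L + 1096 * m).size ≤ κ * ((4 * c + 16) * z) := Nat.mul_le_mul_left _ hsize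
    rw [add_mul] at hw'
    omega

theorem DecidesGap.mono {w T T' : ℕ} {Q : Prog} {X : List ℕ} {t q S : ℕ} (hT : T ≤ T')
    (h : DecidesGap w T Q X t q S) : DecidesGap w T' Q X t q S :=
  fun hp s h8 h0 h1 h7 h18 h19 hm =>
    (h hp s h8 h0 h1 h7 h18 h19 hm).mono fun _ _ h => ⟨h.1.trans hT, h.2⟩

/-- The running time as a function of the block length. -/
theorem time_bound {δ K : ℝ} (hδ : 0 < δ) (hδ1 : δ ≤ 1) (hK : 0 ≤ K) (c : ℕ) :
    ∃ C : ℝ, 0 ≤ C ∧ ∀ k m L T : ℕ, m = 2 ^ k → L = (3 * k + 1) * c + 3 →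
      (T : ℝ) ≤ K * (((4 * m + L : ℕ) + (1096 * m : ℕ) : ℝ) ^ (2 - δ) + (4 * m + L : ℕ) + 1) →
      ((L * (m ^ 4 * (T + 50 * m + 4 * L + 32) + 36 * (m ^ 3 * m ^ 2) + 16 * m ^ 3 + 6) +
        30 * m ^ 3 + 60 : ℕ) : ℝ) ≤ C * (m : ℝ) ^ (6 - δ / 2) := by
  set a : ℝ := 1107 + 4 * c with ha
  set b : ℝ := (3 * c) * (2 / (δ * Real.log 2)) + c + 3 with hb
  have hlog : 0 < Real.log 2 := Real.log_pos (by norm_num)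
  have ha1 : 1 ≤ a := by rw [ha]; have : (0 : ℝ) ≤ c := by positivity
                         linarith
  have hb0 : 0 ≤ b := by positivity
  refine ⟨b * (K * (a ^ 2 + a) + 6 * a + 58) + 90, by positivity, ?_⟩
  intro k m L T hm hL hT
  have hm1 : (1 : ℝ) ≤ m := by rw [hm]; push_cast; exact one_le_pow₀ (by norm_num)
  have hm0 : (0 : ℝ) < m := by linarith
  have hkm : ((k : ℝ) + 1) ≤ m := by
    have : k + 1 ≤ m := hm ▸ Nat.lt_two_pow_self
    exact_mod_cast this
  have hLr : (L : ℝ) = (3 * k + 1) * c + 3 := by rw [hL]; push_cast; ring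
  have hc0 : (0 : ℝ) ≤ c := by positivity
  have hk0 : (0 : ℝ) ≤ k := by positivity
  set M : ℝ := (m : ℝ) with hM
  have hL1 : (L : ℝ) ≤ (3 * c + 3) * M := by rw [hLr]; nlinarith
  have hlen : ((4 * m + L : ℕ) : ℝ) + 1 ≤ a * M := by
    push_cast; rw [ha, ← hM]; nlinarith
  have hbase : ((4 * m + L : ℕ) + (1096 * m : ℕ) : ℝ) ≤ a * M := by
    push_cast; rw [ha, ← hM]; nlinarith
  set R : ℝ := M ^ (2 - δ) with hR
  have hMR : M ≤ R := by
    rw [hR]; conv_lhs => rw [← Real.rpow_one M]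
    exact Real.rpow_le_rpow_of_exponent_le hm1 (by linarith)
  have hR1 : 1 ≤ R := hm1.trans hMR
  have hrpow : ((4 * m + L : ℕ) + (1096 * m : ℕ) : ℝ) ^ (2 - δ) ≤ a ^ 2 * R := by
    calc ((4 * m + L : ℕ) + (1096 * m : ℕ) : ℝ) ^ (2 - δ) ≤ (a * M) ^ (2 - δ) :=
          Real.rpow_le_rpow (by positivity) hbase (by linarith)
      _ = a ^ (2 - δ) * R := Real.mul_rpow (by linarith) hm0.le
      _ ≤ a ^ (2 : ℝ) * R := by
          gcongr
          linarith
      _ = a ^ 2 * R := by norm_num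
  have hT' : (T : ℝ) ≤ K * (a ^ 2 + a) * R := by
    refine hT.trans ?_
    rw [mul_assoc]
    refine mul_le_mul_of_nonneg_left ?_ hK
    nlinarith
  have hinner : (T : ℝ) + 50 * M + 4 * L + 32 ≤ (K * (a ^ 2 + a) + 6 * a) * R := by
    nlinarith
  set U : ℝ := M ^ (6 - δ) with hU
  have hUR : M ^ 4 * R = U := by
    rw [hU, hR, ← Real.rpow_natCast, ← Real.rpow_add hm0]; congr 1; push_cast; ring
  have hpow {j : ℕ} (hj : j ≤ 5) : M ^ j ≤ U := by
    rw [hU, ← Real.rpow_natCast]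
    refine Real.rpow_le_rpow_of_exponent_le hm1 ?_
    have : (j : ℝ) ≤ 5 := by exact_mod_cast hj
    linarith
  have hU1 : 1 ≤ U := by simpa using hpow (j := 0) (by norm_num)
  have hround : M ^ 4 * ((T : ℝ) + 50 * M + 4 * L + 32) + 36 * (M ^ 3 * M ^ 2) + 16 * M ^ 3 + 6 ≤
      (K * (a ^ 2 + a) + 6 * a + 58) * U := by
    have h1 : M ^ 4 * ((T : ℝ) + 50 * M + 4 * L + 32) ≤ (K * (a ^ 2 + a) + 6 * a) * U := by
      rw [← hUR]
      calc _ ≤ M ^ 4 * ((K * (a ^ 2 + a) + 6 * a) * R) :=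
            mul_le_mul_of_nonneg_left hinner (by positivity)
        _ = _ := by ring
    have h2 : M ^ 3 * M ^ 2 ≤ U := by rw [← pow_add]; exact hpow (by norm_num)
    have h3 : M ^ 3 ≤ U := hpow (by norm_num)
    linarith
  -- The number of rounds is logarithmic in `M` and hence at most a constant times `M ^ (δ / 2)`;
  -- this half of the saving is given up.
  set G : ℝ := M ^ (δ / 2) with hG
  have hG1 : 1 ≤ G := Real.one_le_rpow hm1 (by linarith)
  have hkG : (k : ℝ) ≤ 2 / (δ * Real.log 2) * G := by
    have h1 := Real.log_le_rpow_div hm0.le (half_pos hδ)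
    have h2 : Real.log M = k * Real.log 2 := by
      rw [hM, hm]; push_cast; rw [Real.log_pow]
    rw [h2, ← hG] at h1
    rw [div_mul_eq_mul_div, le_div_iff₀ (by positivity)]
    rw [le_div_iff₀ (by positivity)] at h1
    linarith
  have hLG : (L : ℝ) ≤ b * G := by
    rw [hLr, hb]
    nlinarith [mul_le_mul_of_nonneg_left hkG hc0, mul_nonneg hc0 (sub_nonneg.2 hG1)]
  have hGU : M ^ (6 - δ / 2) = G * U := by
    rw [hG, hU, ← Real.rpow_add hm0]; congr 1; ring
  rw [hGU]
  push_cast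
  rw [← hM]
  have h1 : (L : ℝ) * (M ^ 4 * ((T : ℝ) + 50 * M + 4 * L + 32) + 36 * (M ^ 3 * M ^ 2) +
      16 * M ^ 3 + 6) ≤ (b * G) * ((K * (a ^ 2 + a) + 6 * a + 58) * U) :=
    mul_le_mul hLG hround (by positivity) (by positivity)
  have h2 : M ^ 3 ≤ U := hpow (by norm_num)
  have h3 : U ≤ G * U := le_mul_of_one_le_left (by linarith) hG1
  calc _ ≤ (b * G) * ((K * (a ^ 2 + a) + 6 * a + 58) * U) + 30 * U + 60 * U := by linarith
    _ ≤ (b * G) * ((K * (a ^ 2 + a) + 6 * a + 58) * U) + 90 * (G * U) := by linarith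
    _ = _ := by ring

/-- Passing to `min δ 1` makes the brute-force cost `m ^ 5` at most `m ^ (6 - min δ 1)`. The factor
64 in the constant comes from `m ^ 3 ≤ 8 * n`, raised to a power below 2. -/
theorem minConvInTime_of_hasGapSubroutine {δ : ℝ} (hδ : 0 < δ)
    (h : HasGapSubroutine fun n r => ((n : ℝ) + r) ^ (2 - δ)) :
    MinConvInTime fun n => (n : ℝ) ^ (2 - min δ 1 / 6) := by
  intro c
  obtain ⟨Q, κ, K, hK, hQ⟩ := h (3 * c + 4)
  obtain ⟨C, hC, htime⟩ := time_bound (lt_min hδ one_pos) (min_le_right δ 1) hK c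
  refine ⟨minConvProg c Q, (κ + 1) * (4 * c + 16) + 2 * (4 * c + 3) + 40, C * 64, ?_⟩
  intro n A B hn hA hB
  set z := n.size with hz
  set w := ((κ + 1) * (4 * c + 16) + 2 * (4 * c + 3) + 40) * z with hw
  set k := Nat.log 8 n + 1 with hk
  set m := 2 ^ k with hm
  set L := (3 * k + 1) * c + 3 with hL
  set S := 8 * m ^ 3 + 2 ^ L * m ^ 4 with hS
  have hup : n < 8 ^ k := Nat.lt_pow_succ_log_self (by norm_num) n
  have hlog : 8 ^ Nat.log 8 n ≤ n := Nat.pow_log_le_self 8 (by omega)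
  have hlow : ∀ j < k, 8 ^ j ≤ n := fun j hj =>
    (Nat.pow_le_pow_right (by norm_num) (by omega)).trans hlog
  have hv : m ^ 3 = 8 ^ k := by rw [hm, ← pow_mul, mul_comm, pow_mul]; norm_num
  have hz1 : 1 ≤ z := Nat.size_pos.2 hn
  have hzk : z ≤ 3 * k := by
    rw [hz, Nat.size_le, pow_mul]; exact hup
  have hkz : k ≤ z := by
    have h1 : Nat.log 8 n < z := by
      rw [hz, Nat.lt_size]
      exact (Nat.pow_le_pow_left (by norm_num) _).trans hlog
    omega
  obtain ⟨hwb, hw4, hwκ⟩ := wordBounds_of_size (κ := κ) hm hL hS hkz hz1 hw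
  set T := ⌊K * (((4 * m + L : ℕ) + (1096 * m : ℕ) : ℝ) ^ (2 - min δ 1) + (4 * m + L : ℕ) + 1)⌋₊
    with hT
  have hQ' : DecidesBlocks w T m L S Q := by
    intro A' B' C' hA' hB'
    have hv := validGapInput_items (C := C') hm hL hA' hB'
    have h1 := hQ _ _ _ hv w S (by have := hwb.v_le; have := hwb.m_pos; positivity)
    simp only [MinConvInstance.length_items] at h1
    refine (h1 hwκ).mono ?_
    rw [hT]
    gcongr
    · have : (1 : ℝ) ≤ (1096 * m : ℕ) := by exact_mod_cast hv.one_lt.le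
      have : (0 : ℝ) ≤ (4 * m + L : ℕ) := by positivity
      linarith
    · exact min_le_left δ 1
  have hpow : 2 ^ (c * z) ≤ 2 ^ ((3 * k + 1) * c) := by
    refine Nat.pow_le_pow_right (by norm_num) ?_
    rw [mul_comm c]
    exact Nat.mul_le_mul_right _ (by omega)
  obtain ⟨τ, s, he, hτ, hout⟩ := wp_minConvProg hn hlow hup hm rfl hL hS
    (fun i => (hA i).2.trans_le hpow) (fun i => (hB i).2.trans_le hpow) hwb hw4 hQ'
  refine ⟨τ, s, he, ?_, hout⟩
  have ht := htime k m L T hm hL (Nat.floor_le (by positivity))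
  have hτ' : (τ : ℝ) ≤ C * (m : ℝ) ^ (6 - min δ 1 / 2) := le_trans (by exact_mod_cast hτ) ht
  refine hτ'.trans ?_
  rw [mul_assoc]
  refine mul_le_mul_of_nonneg_left ?_ hC
  have hmin0 : 0 < min δ 1 := lt_min hδ one_pos
  have hmin1 : min δ 1 ≤ 1 := min_le_right δ 1
  have e : (m : ℝ) ^ (6 - min δ 1 / 2) = ((m : ℝ) ^ 3) ^ (2 - min δ 1 / 6) := by
    rw [← Real.rpow_natCast, ← Real.rpow_mul (by positivity)]; congr 1; push_cast; ring
  have h8 : (m : ℝ) ^ 3 ≤ 8 * n := by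
    have : m ^ 3 ≤ 8 * n := by rw [hv, hk, pow_succ]; omega
    exact_mod_cast this
  rw [e]
  calc ((m : ℝ) ^ 3) ^ (2 - min δ 1 / 6) ≤ (8 * n : ℝ) ^ (2 - min δ 1 / 6) :=
        Real.rpow_le_rpow (by positivity) h8 (by linarith)
    _ = 8 ^ (2 - min δ 1 / 6) * (n : ℝ) ^ (2 - min δ 1 / 6) :=
        Real.mul_rpow (by norm_num) (by positivity)
    _ ≤ 8 ^ (2 : ℝ) * (n : ℝ) ^ (2 - min δ 1 / 6) := by
        gcongr
        · norm_num
        · linarith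
    _ = 64 * (n : ℝ) ^ (2 - min δ 1 / 6) := by norm_num

end WordRAM

theorem mainTheorem3 :
    ((∃ δ : ℝ, 0 < δ ∧
        SubsetSumApproxSchemeInTime (fun n r => ((n : ℝ) + r) ^ (2 - δ))) →
      ∃ δ' : ℝ, 0 < δ' ∧ MinConvInTime (fun n => (n : ℝ) ^ (2 - δ'))) ∧
    ((∃ δ : ℝ, 0 < δ ∧
        GapSubsetSumInTime (fun n r => ((n : ℝ) + r) ^ (2 - δ))) →
      ∃ δ' : ℝ, 0 < δ' ∧ MinConvInTime (fun n => (n : ℝ) ^ (2 - δ'))) := by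
  have hpos (δ : ℝ) : ∀ (n : ℕ) (r : ℝ), 0 ≤ r → 0 ≤ ((n : ℝ) + r) ^ (2 - δ) :=
    fun n r hr => by positivity
  have hmin {δ : ℝ} (hδ : 0 < δ) : 0 < min δ 1 / 6 := div_pos (lt_min hδ one_pos) (by norm_num)
  constructor
  · rintro ⟨δ, hδ, h⟩
    exact ⟨_, hmin hδ, WordRAM.minConvInTime_of_hasGapSubroutine hδ
      (WordRAM.hasGapSubroutine_of_approx (hpos δ) h)⟩
  · rintro ⟨δ, hδ, h⟩
    exact ⟨_, hmin hδ, WordRAM.minConvInTime_of_hasGapSubroutine hδ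
      (WordRAM.hasGapSubroutine_of_gap (hpos δ) h)⟩
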